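/- Work over $\mathbb{Q}$. A graded Lie algebra is a $\mathbb{Z}$-graded vector space with a bilinear bracket of degree $0$ satisfying $[u,v]=-(-1)^{|u||v|}[v,u]$ and the graded Jacobi identity $(-1)^{|u||w|}[u,[v,w]]+(-1)^{|v||u|}[v,[w,u]]+(-1)^{|w||v|}[w,[u,v]]=0$. Let $\mathbb{L}=\mathbb{L}(a,b,x)$ be the free graded Lie algebra on generators $a,b$ of degree $-1$ and $x$ of degree $0$, and let $\widehat{\mathbb{L}}(a,b,x)=\varprojlim_n \mathbb{L}/\mathbb{L}^n$ be its (degreewise) completion, where $\mathbb{L}^1=\mathbb{L}$ and $\mathbb{L}^n=[\mathbb{L},\mathbb{L}^{n-1}]$. The Lawrence–Sullivan interval is the complete differential graded Lie algebra $\mathfrak{L}=(\widehat{\mathbb{L}}(a,b,x),\partial)$, where $\partial$ is the continuous derivation of degree $-1$ (it satisfies $\partial^2=0$) given on generators by $$\partial a=-\tfrac12[a,a],\qquad \partial b=-\tfrac12[b,b],\qquad \partial x=[x,b]+\sum_{n=0}^{\infty}\frac{B_n}{n!}\,\mathrm{ad}_x^n(b-a),$$ with $B_n$ the Bernoulli numbers,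 $\sum_n \frac{B_n}{n!}t^n=\frac{t}{e^t-1}$. A Maurer–Cartan element of $\mathfrak{L}$ is an element $\omega$ of degree $-1$ with $\partial\omega+\tfrac12[\omega,\omega]=0$. The linear part of an element of $\mathfrak{L}$ is its component of word length one, an element of the span of $a,b,x$. **Proposition.** A Maurer–Cartan element of $\mathfrak{L}$ is completely determined by its linear part: if $\omega$ and $\omega'$ are Maurer–Cartan elements of $\mathfrak{L}$ with the same linear part, then $\omega=\omega'$. -/

import Mathlib

noncomputable section

/-! ### Graded Lie algebras -/

/-- A `ℤ`-graded Lie algebra over `ℚ`, given by its homogeneous components `obj p`.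
The bracket `obj p × obj q → obj (p + q)` takes the target degree `r` together with a proof of
`p + q = r`, so that no transport between equal degrees is ever needed. -/
structure ZGradedLieAlgebra where
  obj : ℤ → Type
  [addCommGroup : ∀ p, AddCommGroup (obj p)]
  [module : ∀ p, Module ℚ (obj p)]
  bracket : ∀ {p q r : ℤ}, p + q = r → (obj p →ₗ[ℚ] obj q →ₗ[ℚ] obj r)
  antisymm : ∀ {p q r : ℤ} (h : p + q = r) (h' : q + p = r) (x : obj p) (y : obj q),
    bracket h x y = -((-1 : ℚ) ^ (p * q) • bracket h' y x)
  jacobi : ∀ {p q r pq qr rp s : ℤ} (hqr : q + r = qr) (hrp : r + p = rp) (hpq : p + q = pq)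
    (h₁ : p + qr = s) (h₂ : q + rp = s) (h₃ : r + pq = s) (x : obj p) (y : obj q) (z : obj r),
    (-1 : ℚ) ^ (p * r) • bracket h₁ x (bracket hqr y z)
      + (-1 : ℚ) ^ (q * p) • bracket h₂ y (bracket hrp z x)
      + (-1 : ℚ) ^ (r * q) • bracket h₃ z (bracket hpq x y) = 0

attribute [instance] ZGradedLieAlgebra.addCommGroup ZGradedLieAlgebra.module

/-- A linear derivation of degree `-1` of a graded Lie algebra. -/
structure ZGradedLieAlgebra.Derivation (L : ZGradedLieAlgebra) where
  map : ∀ {p q : ℤ}, q + 1 = p → (L.obj p →ₗ[ℚ] L.obj q)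
  leibniz : ∀ {p q r p' q' r' : ℤ} (h : p + q = r) (hp : p' + 1 = p) (hq : q' + 1 = q)
    (hr : r' + 1 = r) (h₁ : p' + q = r') (h₂ : p + q' = r') (x : L.obj p) (y : L.obj q),
    map hr (L.bracket h x y)
      = L.bracket h₁ (map hp x) y + (-1 : ℚ) ^ p • L.bracket h₂ x (map hq y)

/-- A differential graded Lie algebra: a graded Lie algebra with a derivation of degree `-1`
of square zero. -/
structure DGLieAlgebra extends ZGradedLieAlgebra where
  d : toZGradedLieAlgebra.Derivation
  d_sq : ∀ {p q r : ℤ} (hp : q + 1 = p) (hq : r + 1 = q) (x : obj p), d.map hq (d.map hp x) = 0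

/-- The Maurer-Cartan elements: `z` of degree `-1` with `∂ z + ½ [z, z] = 0`. -/
def DGLieAlgebra.MC (L : DGLieAlgebra) : Set (L.obj (-1)) :=
  {z | L.d.map (p := -1) (q := -2) (by norm_num) z
    + (1 / 2 : ℚ) • L.bracket (p := -1) (q := -1) (r := -2) (by norm_num) z z = 0}

/-! ### Completion -/

/-- Bilinear maps descend to quotients. -/
def quotBilin {M N P : Type*} [AddCommGroup M] [Module ℚ M] [AddCommGroup N] [Module ℚ N]
    [AddCommGroup P] [Module ℚ P] (I : Submodule ℚ M) (J : Submodule ℚ N) (K : Submodule ℚ P)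
    (B : M →ₗ[ℚ] N →ₗ[ℚ] P) (hI : ∀ x ∈ I, ∀ y, B x y ∈ K) (hJ : ∀ x, ∀ y ∈ J, B x y ∈ K) :
    (M ⧸ I) →ₗ[ℚ] (N ⧸ J) →ₗ[ℚ] (P ⧸ K) :=
  (J.liftQ (I.liftQ (B.compr₂ K.mkQ) (fun x hx => by
      ext y
      simpa using hI x hx y)).flip (fun y hy => by
      ext x
      exact (Submodule.Quotient.mk_eq_zero K).2 (hJ x y hy))).flip

theorem quotBilin_mk {M N P : Type*} [AddCommGroup M] [Module ℚ M] [AddCommGroup N] [Module ℚ N]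
    [AddCommGroup P] [Module ℚ P] (I : Submodule ℚ M) (J : Submodule ℚ N) (K : Submodule ℚ P)
    (B : M →ₗ[ℚ] N →ₗ[ℚ] P) (hI : ∀ x ∈ I, ∀ y, B x y ∈ K) (hJ : ∀ x, ∀ y ∈ J, B x y ∈ K)
    (x : M) (y : N) : quotBilin I J K B hI hJ (I.mkQ x) (J.mkQ y) = K.mkQ (B x y) := rfl

namespace ZGradedLieAlgebra

variable (L : ZGradedLieAlgebra)

/-- The lower central series `L¹ = L`, `Lⁿ = [L, Lⁿ⁻¹]`, by homogeneous components and with the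
index shifted by one: `L.lcs n p` is the degree `p` component of `Lⁿ⁺¹`. -/
def lcs : ℕ → ∀ p : ℤ, Submodule ℚ (L.obj p)
  | 0, _ => ⊤
  | n + 1, r => Submodule.span ℚ
      {z | ∃ (p q : ℤ) (h : p + q = r) (x : L.obj p) (y : L.obj q),
        y ∈ lcs n q ∧ z = L.bracket h x y}

variable {L}

theorem bracket_mem_lcs_succ {n : ℕ} {p q r : ℤ} (h : p + q = r) (x : L.obj p) {y : L.obj q}
    (hy : y ∈ L.lcs n q) : L.bracket h x y ∈ L.lcs (n + 1) r :=
  Submodule.subset_span ⟨p, q, h, x, y, hy, rfl⟩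

theorem lcs_succ_le (n : ℕ) (p : ℤ) : L.lcs (n + 1) p ≤ L.lcs n p := by
  induction n generalizing p with
  | zero => exact le_top
  | succ n ih =>
    refine Submodule.span_le.2 ?_
    rintro _ ⟨p', q, h, x, y, hy, rfl⟩
    exact bracket_mem_lcs_succ h x (ih q hy)

theorem lcs_anti {m n : ℕ} (h : m ≤ n) (p : ℤ) : L.lcs n p ≤ L.lcs m p :=
  antitone_nat_of_succ_le (f := fun n => L.lcs n p) (fun n => lcs_succ_le n p) h

theorem bracket_mem_lcs_right {n : ℕ} {p q r : ℤ} (h : p + q = r) (x : L.obj p) {y : L.obj q}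
    (hy : y ∈ L.lcs n q) : L.bracket h x y ∈ L.lcs n r :=
  lcs_succ_le n r (bracket_mem_lcs_succ h x hy)

theorem bracket_mem_lcs_succ' {n : ℕ} {p q r : ℤ} (h : p + q = r) {x : L.obj p}
    (hx : x ∈ L.lcs n p) (y : L.obj q) : L.bracket h x y ∈ L.lcs (n + 1) r := by
  rw [L.antisymm h (by omega) x y]
  exact neg_mem (Submodule.smul_mem _ _ (bracket_mem_lcs_succ _ y hx))

theorem bracket_mem_lcs_left {n : ℕ} {p q r : ℤ} (h : p + q = r) {x : L.obj p}
    (hx : x ∈ L.lcs n p) (y : L.obj q) : L.bracket h x y ∈ L.lcs n r :=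
  lcs_succ_le n r (bracket_mem_lcs_succ' h hx y)

variable (L)

/-- The degree `p` component of the projective limit of the `L / Lⁿ`. -/
def completionObj (p : ℤ) : Submodule ℚ (∀ n : ℕ, L.obj p ⧸ L.lcs n p) where
  carrier := {s | ∀ (m n : ℕ) (h : m ≤ n), Submodule.factor (lcs_anti h p) (s n) = s m}
  add_mem' := fun hs ht m n h => by simp [hs m n h, ht m n h]
  zero_mem' := fun m n h => by simp
  smul_mem' := fun c s hs m n h => by simp [hs m n h]

variable {L}

/-- The bracket of `L / Lⁿ⁺¹`. -/
def quotBracket (n : ℕ) {p q r : ℤ} (h : p + q = r) :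
    (L.obj p ⧸ L.lcs n p) →ₗ[ℚ] (L.obj q ⧸ L.lcs n q) →ₗ[ℚ] (L.obj r ⧸ L.lcs n r) :=
  quotBilin _ _ _ (L.bracket h) (fun _ hx y => bracket_mem_lcs_left h hx y)
    (fun x _ hy => bracket_mem_lcs_right h x hy)

theorem quotBracket_mk (n : ℕ) {p q r : ℤ} (h : p + q = r) (x : L.obj p) (y : L.obj q) :
    quotBracket n h ((L.lcs n p).mkQ x) ((L.lcs n q).mkQ y) = (L.lcs n r).mkQ (L.bracket h x y) :=
  rfl

/-- The bracket of the projective limit. -/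
def completionBracket {p q r : ℤ} (h : p + q = r) :
    L.completionObj p →ₗ[ℚ] L.completionObj q →ₗ[ℚ] L.completionObj r :=
  LinearMap.mk₂ ℚ
    (fun s t => ⟨fun n => quotBracket n h (s.1 n) (t.1 n), fun m n hmn => by
      beta_reduce
      rw [← s.2 m n hmn, ← t.2 m n hmn]
      obtain ⟨x, hx⟩ := Submodule.mkQ_surjective _ (s.1 n)
      obtain ⟨y, hy⟩ := Submodule.mkQ_surjective _ (t.1 n)
      rw [← hx, ← hy]
      rfl⟩)
    (fun s s' t => by ext n; simp)
    (fun c s t => by ext n; simp)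
    (fun s t t' => by ext n; simp)
    (fun c s t => by ext n; simp)

theorem completionBracket_apply {p q r : ℤ} (h : p + q = r) (s : L.completionObj p)
    (t : L.completionObj q) (n : ℕ) :
    (completionBracket h s t).1 n = quotBracket n h (s.1 n) (t.1 n) := rfl

variable (L)

/-- The completion `lim L / Lⁿ`. -/
@[reducible] def completion : ZGradedLieAlgebra where
  obj p := L.completionObj p
  bracket h := completionBracket h
  antisymm {p q r} h h' s t := by
    refine Subtype.ext (funext fun n => ?_)
    obtain ⟨x, hx⟩ := Submodule.mkQ_surjective _ (s.1 n)
    obtain ⟨y, hy⟩ := Submodule.mkQ_surjective _ (t.1 n)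
    have := congrArg (L.lcs n r).mkQ (L.antisymm h h' x y)
    simp only [map_neg, map_smul, ← quotBracket_mk, hx, hy] at this
    exact this
  jacobi {p q r pq qr rp s} hqr hrp hpq h₁ h₂ h₃ a b c := by
    refine Subtype.ext (funext fun n => ?_)
    obtain ⟨x, hx⟩ := Submodule.mkQ_surjective _ (a.1 n)
    obtain ⟨y, hy⟩ := Submodule.mkQ_surjective _ (b.1 n)
    obtain ⟨z, hz⟩ := Submodule.mkQ_surjective _ (c.1 n)
    have := congrArg (L.lcs n s).mkQ (L.jacobi hqr hrp hpq h₁ h₂ h₃ x y z)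
    simp only [map_add, map_smul, map_zero, ← quotBracket_mk, hx, hy, hz] at this
    exact this

/-- The canonical map from a graded Lie algebra to its completion. -/
def toCompletion (p : ℤ) : L.obj p →ₗ[ℚ] L.completion.obj p where
  toFun x := ⟨fun n => (L.lcs n p).mkQ x, fun _ _ _ => rfl⟩
  map_add' _ _ := rfl
  map_smul' _ _ := rfl

variable {L}

theorem toCompletion_bracket {p q r : ℤ} (h : p + q = r) (x : L.obj p) (y : L.obj q) :
    L.toCompletion r (L.bracket h x y)
      = L.completion.bracket h (L.toCompletion p x) (L.toCompletion q y) := rfl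

theorem completion_eq_zero_of_le {p : ℤ} (s : L.completion.obj p) {m n : ℕ} (h : m ≤ n)
    (hs : s.1 n = 0) : s.1 m = 0 := by
  rw [← s.2 m n h, hs, map_zero]

theorem completion_bracket_right {p q r : ℤ} (h : p + q = r) (s : L.completion.obj p)
    (t : L.completion.obj q) (n : ℕ) (ht : t.1 n = 0) :
    (L.completion.bracket h s t).1 (n + 1) = 0 := by
  obtain ⟨x, hx⟩ := Submodule.mkQ_surjective _ (s.1 (n + 1))
  obtain ⟨y, hy⟩ := Submodule.mkQ_surjective _ (t.1 (n + 1))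
  have hy' : y ∈ L.lcs n q := by
    rw [← t.2 n (n + 1) n.le_succ, ← hy] at ht
    exact (Submodule.Quotient.mk_eq_zero _).1 ht
  rw [completionBracket_apply, ← hx, ← hy, quotBracket_mk]
  exact (Submodule.Quotient.mk_eq_zero _).2 (bracket_mem_lcs_succ h x hy')

theorem ad_pow_eq_zero {p : ℤ} (x : L.completion.obj 0) (z : L.completion.obj p) (k n : ℕ)
    (h : n ≤ k) : ((L.completion.bracket (zero_add p) x ^ k) z).1 n = 0 := by
  refine completion_eq_zero_of_le _ h ?_
  clear h
  induction k with
  | zero =>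
    obtain ⟨y, hy⟩ := Submodule.mkQ_surjective _ (z.1 0)
    exact hy.symm.trans ((Submodule.Quotient.mk_eq_zero _).2 Submodule.mem_top)
  | succ k ih =>
    rw [pow_succ', Module.End.mul_apply]
    exact completion_bracket_right _ _ _ _ ih

theorem adSeries_partial {p : ℤ} (c : ℕ → ℚ) (x : L.completion.obj 0) (z : L.completion.obj p)
    {m n : ℕ} (h : m ≤ n) :
    (∑ k ∈ Finset.range n, c k • (L.completion.bracket (zero_add p) x ^ k) z).1 m
      = (∑ k ∈ Finset.range m, c k • (L.completion.bracket (zero_add p) x ^ k) z).1 m := by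
  induction n, h using Nat.le_induction with
  | base => rfl
  | succ n h ih =>
    rw [Finset.sum_range_succ, Submodule.coe_add, Pi.add_apply, ih, Submodule.coe_smul,
      Pi.smul_apply, ad_pow_eq_zero x z n m h, smul_zero, add_zero]

/-- The sum of the series `∑ₖ cₖ adₓᵏ(z)` in the completion, for `x` of degree `0`: its class
modulo `Lⁿ⁺¹` is that of the `n`-th partial sum, since `adₓᵏ(z)` lies in `Lᵏ⁺¹`. -/
def adSeries {p : ℤ} (c : ℕ → ℚ) (x : L.completion.obj 0) (z : L.completion.obj p) :
    L.completion.obj p :=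
  ⟨fun n => (∑ k ∈ Finset.range n, c k • (L.completion.bracket (zero_add p) x ^ k) z).1 n,
    fun m n h => by
      rw [(∑ k ∈ Finset.range n, c k • (L.completion.bracket (zero_add p) x ^ k) z).2 m n h]
      exact adSeries_partial c x z h⟩

end ZGradedLieAlgebra

/-! ### Free graded Lie algebras -/

namespace FreeZGradedLie

variable {X : Type} (deg : X → ℤ)

/-- The degree of a nonassociative word in generators of given degrees. -/
def wordDeg : FreeMagma X → ℤ
  | .of g => deg g
  | .mul u v => wordDeg u + wordDeg v

/-- Degree `p` component of the free nonassociative algebra: formal linear combinations of words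
of degree `p`. -/
abbrev Magma (p : ℤ) : Type := {w : FreeMagma X // wordDeg deg w = p} →₀ ℚ

variable {deg}

/-- A word, as an element of the free nonassociative algebra. -/
def word (w : FreeMagma X) {p : ℤ} (h : wordDeg deg w = p) : Magma deg p := Finsupp.single ⟨w, h⟩ 1

theorem wordDeg_mul {p q r : ℤ} (h : p + q = r) {u v : FreeMagma X} (hu : wordDeg deg u = p)
    (hv : wordDeg deg v = q) : wordDeg deg (.mul u v) = r := by
  subst h hu hv; rfl

/-- The product of the free nonassociative algebra. -/
def magmaMul {p q r : ℤ} (h : p + q = r) : Magma deg p →ₗ[ℚ] Magma deg q →ₗ[ℚ] Magma deg r :=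
  Finsupp.linearCombination ℚ fun u => Finsupp.lmapDomain ℚ ℚ
    fun v => ⟨.mul u.1 v.1, wordDeg_mul h u.2 v.2⟩

theorem magmaMul_word {p q r : ℤ} (h : p + q = r) {u v : FreeMagma X} (hu : wordDeg deg u = p)
    (hv : wordDeg deg v = q) : magmaMul h (word u hu) (word v hv)
      = word (.mul u v) (wordDeg_mul h hu hv) := by
  simp [magmaMul, word]

/-- The defining relations of the free graded Lie algebra: graded antisymmetry and the graded
Jacobi identity on words, and their consequences under multiplication by words. -/
inductive Relator : ∀ {p : ℤ}, Magma deg p → Prop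
  | antisymm {p q r : ℤ} (u v : FreeMagma X) (hu : wordDeg deg u = p) (hv : wordDeg deg v = q)
      (h : p + q = r) (h' : q + p = r) :
      Relator (magmaMul h (word u hu) (word v hv)
        + (-1 : ℚ) ^ (p * q) • magmaMul h' (word v hv) (word u hu))
  | jacobi {p q r pq qr rp s : ℤ} (u v w : FreeMagma X) (hu : wordDeg deg u = p)
      (hv : wordDeg deg v = q) (hw : wordDeg deg w = r)
      (hqr : q + r = qr) (hrp : r + p = rp) (hpq : p + q = pq)
      (h₁ : p + qr = s) (h₂ : q + rp = s) (h₃ : r + pq = s) :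
      Relator ((-1 : ℚ) ^ (p * r) • magmaMul h₁ (word u hu) (magmaMul hqr (word v hv) (word w hw))
        + (-1 : ℚ) ^ (q * p) • magmaMul h₂ (word v hv) (magmaMul hrp (word w hw) (word u hu))
        + (-1 : ℚ) ^ (r * q) • magmaMul h₃ (word w hw) (magmaMul hpq (word u hu) (word v hv)))
  | mul_left {p q r : ℤ} (h : p + q = r) (u : FreeMagma X) (hu : wordDeg deg u = p)
      (x : Magma deg q) : Relator x → Relator (magmaMul h (word u hu) x)
  | mul_right {p q r : ℤ} (h : p + q = r) (x : Magma deg p) (v : FreeMagma X)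
      (hv : wordDeg deg v = q) : Relator x → Relator (magmaMul h x (word v hv))

variable (deg)

/-- The homogeneous ideal generated by the relations. -/
def ideal (p : ℤ) : Submodule ℚ (Magma deg p) := Submodule.span ℚ {x | Relator x}

variable {deg}

/-- Linear maps out of `Magma` that agree on words are equal; as an induction principle. -/
theorem magma_induction {p : ℤ} {P : Magma deg p → Prop} (x : Magma deg p)
    (word : ∀ w (h : wordDeg deg w = p), P (word w h)) (zero : P 0)
    (add : ∀ x y, P x → P y → P (x + y)) (smul : ∀ (c : ℚ) x, P x → P (c • x)) : P x := by
  induction x using Finsupp.induction_linear with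
  | zero => exact zero
  | add f g hf hg => exact add f g hf hg
  | single w c =>
    have := smul c _ (word w.1 w.2)
    rwa [FreeZGradedLie.word, Finsupp.smul_single, smul_eq_mul, mul_one] at this

theorem mul_mem_ideal_right {p q r : ℤ} (h : p + q = r) (x : Magma deg p) (y : Magma deg q)
    (hy : y ∈ ideal deg q) : magmaMul h x y ∈ ideal deg r := by
  induction x using magma_induction with
  | word w hw =>
    refine (Submodule.span_le (p := (ideal deg r).comap (magmaMul h (word w hw)))).2 ?_ hy
    intro y hy
    exact Submodule.subset_span (Relator.mul_left h w hw y hy)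
  | zero => simp
  | add x y hx hy => simpa using add_mem hx hy
  | smul c x hx => simpa using Submodule.smul_mem _ c hx

theorem mul_mem_ideal_left {p q r : ℤ} (h : p + q = r) (x : Magma deg p) (hx : x ∈ ideal deg p)
    (y : Magma deg q) : magmaMul h x y ∈ ideal deg r := by
  induction y using magma_induction with
  | word w hw =>
    refine (Submodule.span_le (p := (ideal deg r).comap ((magmaMul h).flip (word w hw)))).2 ?_ hx
    intro x hx
    exact Submodule.subset_span (Relator.mul_right h x w hw hx)
  | zero => simp
  | add x y hx hy => simpa using add_mem hx hy
  | smul c x hx => simpa using Submodule.smul_mem _ c hx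

theorem antisymm_mem {p q r : ℤ} (h : p + q = r) (h' : q + p = r) (x : Magma deg p)
    (y : Magma deg q) :
    magmaMul h x y + (-1 : ℚ) ^ (p * q) • magmaMul h' y x ∈ ideal deg r := by
  induction x using magma_induction with
  | zero => simp
  | add x x' hx hx' =>
    have := add_mem hx hx'
    simp only [map_add, LinearMap.add_apply, smul_add] at this ⊢
    convert this using 1; abel
  | smul c x hx =>
    have := Submodule.smul_mem _ c hx
    simp only [map_smul, LinearMap.smul_apply, smul_add] at this ⊢
    rwa [smul_comm]
  | word u hu =>
  induction y using magma_induction with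
  | zero => simp
  | add x x' hx hx' =>
    have := add_mem hx hx'
    simp only [map_add, LinearMap.add_apply, smul_add] at this ⊢
    convert this using 1; abel
  | smul c x hx =>
    have := Submodule.smul_mem _ c hx
    simp only [map_smul, LinearMap.smul_apply, smul_add] at this ⊢
    rwa [smul_comm]
  | word v hv => exact Submodule.subset_span (Relator.antisymm u v hu hv h h')

theorem jacobi_mem {p q r pq qr rp s : ℤ} (hqr : q + r = qr) (hrp : r + p = rp) (hpq : p + q = pq)
    (h₁ : p + qr = s) (h₂ : q + rp = s) (h₃ : r + pq = s) (x : Magma deg p) (y : Magma deg q)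
    (z : Magma deg r) :
    (-1 : ℚ) ^ (p * r) • magmaMul h₁ x (magmaMul hqr y z)
      + (-1 : ℚ) ^ (q * p) • magmaMul h₂ y (magmaMul hrp z x)
      + (-1 : ℚ) ^ (r * q) • magmaMul h₃ z (magmaMul hpq x y) ∈ ideal deg s := by
  induction x using magma_induction with
  | zero => simp
  | add x x' hx hx' =>
    have := add_mem hx hx'
    simp only [map_add, LinearMap.add_apply, smul_add] at this ⊢
    convert this using 1; abel
  | smul c x hx =>
    have := Submodule.smul_mem _ c hx
    simp only [map_smul, LinearMap.smul_apply, smul_add] at this ⊢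
    convert this using 1; module
  | word u hu =>
  induction y using magma_induction with
  | zero => simp
  | add x x' hx hx' =>
    have := add_mem hx hx'
    simp only [map_add, LinearMap.add_apply, smul_add] at this ⊢
    convert this using 1; abel
  | smul c x hx =>
    have := Submodule.smul_mem _ c hx
    simp only [map_smul, LinearMap.smul_apply, smul_add] at this ⊢
    convert this using 1; module
  | word v hv =>
  induction z using magma_induction with
  | zero => simp
  | add x x' hx hx' =>
    have := add_mem hx hx'
    simp only [map_add, LinearMap.add_apply, smul_add] at this ⊢
    convert this using 1; abel
  | smul c x hx =>
    have := Submodule.smul_mem _ c hx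
    simp only [map_smul, LinearMap.smul_apply, smul_add] at this ⊢
    convert this using 1; module
  | word w hw => exact Submodule.subset_span (Relator.jacobi u v w hu hv hw hqr hrp hpq h₁ h₂ h₃)

end FreeZGradedLie

open FreeZGradedLie in
/-- The free graded Lie algebra `𝕃(V)` over `ℚ`, for `V` the graded vector space with basis `X`
and degrees given by `deg`: the quotient of the free nonassociative algebra by the ideal of graded
antisymmetry and graded Jacobi relations. -/
@[reducible] def FreeZGradedLie {X : Type} (deg : X → ℤ) : ZGradedLieAlgebra where
  obj p := Magma deg p ⧸ ideal deg p
  bracket h := quotBilin _ _ _ (magmaMul h) (mul_mem_ideal_left h) (mul_mem_ideal_right h)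
  antisymm {p q r} h h' x y := by
    obtain ⟨x, rfl⟩ := Submodule.mkQ_surjective _ x
    obtain ⟨y, rfl⟩ := Submodule.mkQ_surjective _ y
    rw [eq_neg_iff_add_eq_zero]
    exact (Submodule.Quotient.mk_eq_zero _).2 (antisymm_mem h h' x y)
  jacobi hqr hrp hpq h₁ h₂ h₃ x y z := by
    obtain ⟨x, rfl⟩ := Submodule.mkQ_surjective _ x
    obtain ⟨y, rfl⟩ := Submodule.mkQ_surjective _ y
    obtain ⟨z, rfl⟩ := Submodule.mkQ_surjective _ z
    exact (Submodule.Quotient.mk_eq_zero _).2 (jacobi_mem hqr hrp hpq h₁ h₂ h₃ x y z)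

namespace FreeZGradedLie

variable {X : Type} {deg : X → ℤ}

/-- The completed free graded Lie algebra. -/
@[reducible] def Complete (deg : X → ℤ) : ZGradedLieAlgebra := (FreeZGradedLie deg).completion

/-- The canonical map from the free nonassociative algebra to the completed free Lie algebra. -/
def incl (p : ℤ) : Magma deg p →ₗ[ℚ] (Complete deg).obj p :=
  (FreeZGradedLie deg).toCompletion p ∘ₗ (ideal deg p).mkQ

theorem incl_mul {p q r : ℤ} (h : p + q = r) (x : Magma deg p) (y : Magma deg q) :
    incl r (magmaMul h x y) = (Complete deg).bracket h (incl p x) (incl q y) := rfl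

/-- The generators, as elements of the completed free Lie algebra. -/
def gen (g : X) {p : ℤ} (h : deg g = p) : (Complete deg).obj p := incl p (word (.of g) h)

/-! #### The linear part -/

variable (deg)

/-- The word length one part of an element of the free nonassociative algebra. -/
def magmaLinear (p : ℤ) : Magma deg p →ₗ[ℚ] (X →₀ ℚ) :=
  Finsupp.linearCombination ℚ fun w => match w.1 with
    | .of g => Finsupp.single g 1
    | .mul _ _ => 0

variable {deg}

theorem magmaLinear_mul {p q r : ℤ} (h : p + q = r) (x : Magma deg p) (y : Magma deg q) :
    magmaLinear deg r (magmaMul h x y) = 0 := by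
  induction x using magma_induction with
  | zero => simp
  | add x x' hx hx' => simp [hx, hx']
  | smul c x hx => simp [hx]
  | word u hu =>
  induction y using magma_induction with
  | zero => simp
  | add x x' hx hx' => simp [hx, hx']
  | smul c x hx => simp [hx]
  | word v hv =>
    rw [magmaMul_word]
    simp [magmaLinear, word]

theorem ideal_le_ker_magmaLinear (p : ℤ) : ideal deg p ≤ LinearMap.ker (magmaLinear deg p) := by
  refine Submodule.span_le.2 ?_
  intro x hx
  cases hx <;> simp [magmaLinear_mul]

variable (deg)

/-- The word length one part of an element of the free Lie algebra. -/
def freeLinear (p : ℤ) : (FreeZGradedLie deg).obj p →ₗ[ℚ] (X →₀ ℚ) :=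
  (ideal deg p).liftQ (magmaLinear deg p) (ideal_le_ker_magmaLinear p)

variable {deg}

theorem lcs_le_ker_freeLinear (p : ℤ) :
    (FreeZGradedLie deg).lcs 1 p ≤ LinearMap.ker (freeLinear deg p) := by
  refine Submodule.span_le.2 ?_
  rintro _ ⟨p', q, h, x, y, -, rfl⟩
  obtain ⟨x, rfl⟩ := Submodule.mkQ_surjective _ x
  obtain ⟨y, rfl⟩ := Submodule.mkQ_surjective _ y
  exact magmaLinear_mul h x y

/-- The linear part of an element of the completed free Lie algebra: its component of word length
one, an element of the vector space `V` with basis `X`. It is read off from the class modulo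
`L² = [L, L]`. -/
def linearPart (p : ℤ) : (Complete deg).obj p →ₗ[ℚ] (X →₀ ℚ) :=
  ((FreeZGradedLie deg).lcs 1 p).liftQ (freeLinear deg p) (lcs_le_ker_freeLinear p)
    ∘ₗ LinearMap.proj 1 ∘ₗ Submodule.subtype _

end FreeZGradedLie

/-! ### Derivations of degree `-1` of the completed free Lie algebra -/

namespace FreeZGradedLie

variable {X : Type} {deg : X → ℤ}

/-- Values of a derivation of degree `-1` on the generators. -/
abbrev GenValues (deg : X → ℤ) : Type :=
  ∀ (g : X) (q : ℤ), q + 1 = deg g → (Complete deg).obj q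

/-- The derivation with given values on generators, on words: `∂ g` is given and
`∂ [u, v] = [∂ u, v] + (-1)^|u| [u, ∂ v]`. -/
def dWord (f : GenValues deg) : ∀ (w : FreeMagma X) (q : ℤ), q + 1 = wordDeg deg w →
    (Complete deg).obj q
  | .of g, q, h => f g q h
  | .mul u v, q, h =>
    (Complete deg).bracket (p := wordDeg deg u - 1) (q := wordDeg deg v)
        (by rw [wordDeg] at h; omega) (dWord f u _ (by omega)) (incl _ (word v rfl))
      + (-1 : ℚ) ^ wordDeg deg u •
        (Complete deg).bracket (p := wordDeg deg u) (q := wordDeg deg v - 1)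
          (by rw [wordDeg] at h; omega) (incl _ (word u rfl)) (dWord f v _ (by omega))

/-- The derivation with given values on generators, on the free nonassociative algebra. -/
def dMagma (f : GenValues deg) {p q : ℤ} (h : q + 1 = p) :
    Magma deg p →ₗ[ℚ] (Complete deg).obj q :=
  Finsupp.linearCombination ℚ fun w => dWord f w.1 q (h.trans w.2.symm)

theorem dMagma_word (f : GenValues deg) {p q : ℤ} (h : q + 1 = p) (w : FreeMagma X)
    (hw : wordDeg deg w = p) : dMagma f h (word w hw) = dWord f w q (h.trans hw.symm) := by
  simp [dMagma, word]

theorem dMagma_mul (f : GenValues deg) {p q r p' q' r' : ℤ} (h : p + q = r) (hp : p' + 1 = p)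
    (hq : q' + 1 = q) (hr : r' + 1 = r) (h₁ : p' + q = r') (h₂ : p + q' = r')
    (x : Magma deg p) (y : Magma deg q) :
    dMagma f hr (magmaMul h x y) = (Complete deg).bracket h₁ (dMagma f hp x) (incl q y)
      + (-1 : ℚ) ^ p • (Complete deg).bracket h₂ (incl p x) (dMagma f hq y) := by
  induction x using magma_induction with
  | zero => simp
  | add x x' hx hx' =>
    simp only [map_add, LinearMap.add_apply, smul_add, hx, hx']; abel
  | smul c x hx =>
    simp only [map_smul, LinearMap.smul_apply, smul_add, hx]; module
  | word u hu =>
  induction y using magma_induction with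
  | zero => simp
  | add x x' hx hx' =>
    simp only [map_add, smul_add, hx, hx']; abel
  | smul c x hx =>
    simp only [map_smul, smul_add, hx]; module
  | word v hv =>
    cases hu
    cases hv
    obtain rfl : p' = wordDeg deg u - 1 := by omega
    obtain rfl : q' = wordDeg deg v - 1 := by omega
    rw [magmaMul_word, dMagma_word, dMagma_word, dMagma_word, dWord]

theorem sign_eq (n : ℤ) : (-1 : ℚ) ^ n = if Even n then 1 else -1 := by
  split_ifs with h
  · exact h.neg_one_zpow
  · exact (Int.not_even_iff_odd.1 h).neg_one_zpow

/-- The Leibniz rule is compatible with graded antisymmetry. -/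
theorem leibniz_antisymm (L : ZGradedLieAlgebra) {p q r p' q' : ℤ} (hp : p' + 1 = p)
    (hq : q' + 1 = q) (h₁ : p' + q = r) (h₂ : p + q' = r) (h₃ : q' + p = r) (h₄ : q + p' = r)
    (x : L.obj p) (y : L.obj q) (dx : L.obj p') (dy : L.obj q') :
    (L.bracket h₁ dx y + (-1 : ℚ) ^ p • L.bracket h₂ x dy)
      + (-1 : ℚ) ^ (p * q) • (L.bracket h₃ dy x + (-1 : ℚ) ^ q • L.bracket h₄ y dx) = 0 := by
  obtain rfl : p' = p - 1 := by omega
  obtain rfl : q' = q - 1 := by omega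
  rw [L.antisymm h₃ h₂, L.antisymm h₄ h₁]
  generalize L.bracket h₁ dx y = a
  generalize L.bracket h₂ x dy = b
  simp only [sign_eq, Int.even_sub, Int.even_mul]
  by_cases hp : Even p <;> by_cases hq : Even q <;> simp [hp, hq]

/-- The Leibniz rule is compatible with the graded Jacobi identity. -/
theorem leibniz_jacobi (L : ZGradedLieAlgebra) {p q r p' q' r' pq qr rp pq' qr' rp' s : ℤ}
    (hp : p' + 1 = p) (hq : q' + 1 = q) (hr : r' + 1 = r)
    (hqr : q + r = qr) (hrp : r + p = rp) (hpq : p + q = pq)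
    (hqr₁ : q' + r = qr') (hrp₁ : r' + p = rp') (hpq₁ : p' + q = pq')
    (hqr₂ : q + r' = qr') (hrp₂ : r + p' = rp') (hpq₂ : p + q' = pq')
    (h₁ : p' + qr = s) (h₂ : q' + rp = s) (h₃ : r' + pq = s)
    (h₁' : p + qr' = s) (h₂' : q + rp' = s) (h₃' : r + pq' = s)
    (x : L.obj p) (y : L.obj q) (z : L.obj r) (dx : L.obj p') (dy : L.obj q') (dz : L.obj r') :
    (-1 : ℚ) ^ (p * r) • (L.bracket h₁ dx (L.bracket hqr y z) + (-1 : ℚ) ^ p • L.bracket h₁' x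
        (L.bracket hqr₁ dy z + (-1 : ℚ) ^ q • L.bracket hqr₂ y dz))
      + (-1 : ℚ) ^ (q * p) • (L.bracket h₂ dy (L.bracket hrp z x) + (-1 : ℚ) ^ q • L.bracket h₂' y
        (L.bracket hrp₁ dz x + (-1 : ℚ) ^ r • L.bracket hrp₂ z dx))
      + (-1 : ℚ) ^ (r * q) • (L.bracket h₃ dz (L.bracket hpq x y) + (-1 : ℚ) ^ r • L.bracket h₃' z
        (L.bracket hpq₁ dx y + (-1 : ℚ) ^ p • L.bracket hpq₂ x dy)) = 0 := by
  obtain rfl : p' = p - 1 := by omega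
  obtain rfl : q' = q - 1 := by omega
  obtain rfl : r' = r - 1 := by omega
  have J₁ := L.jacobi hqr hrp₂ hpq₁ h₁ h₂' h₃' dx y z
  have J₂ := L.jacobi hqr₁ hrp hpq₂ h₁' h₂ h₃' x dy z
  have J₃ := L.jacobi hqr₂ hrp₁ hpq h₁' h₂' h₃ x y dz
  simp only [map_add, map_smul]
  generalize L.bracket h₁ dx (L.bracket hqr y z) = a₁ at *
  generalize L.bracket h₂ dy (L.bracket hrp z x) = a₂ at *
  generalize L.bracket h₃ dz (L.bracket hpq x y) = a₃ at *
  generalize L.bracket h₁' x (L.bracket hqr₁ dy z) = b₁ at *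
  generalize L.bracket h₁' x (L.bracket hqr₂ y dz) = b₂ at *
  generalize L.bracket h₂' y (L.bracket hrp₁ dz x) = c₁ at *
  generalize L.bracket h₂' y (L.bracket hrp₂ z dx) = c₂ at *
  generalize L.bracket h₃' z (L.bracket hpq₁ dx y) = e₁ at *
  generalize L.bracket h₃' z (L.bracket hpq₂ x dy) = e₂ at *
  have key : ∀ {u v w : L.obj s} (α β γ : ℚ), u = 0 → v = 0 → w = 0 →
      α • u + β • v + γ • w = 0 := by
    rintro _ _ _ α β γ rfl rfl rfl; simp
  rw [← key ((-1) ^ r) ((-1) ^ p) ((-1) ^ q) J₁ J₂ J₃]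
  simp only [sign_eq, Int.even_sub, Int.even_mul]
  by_cases hp : Even p <;> by_cases hq : Even q <;> by_cases hr : Even r <;>
    simp only [hp, hq, hr, Int.not_even_one, if_true, if_false, iff_false, or_true,
      true_or, or_self, not_true] <;> module

theorem dMagma_ideal (f : GenValues deg) {p q : ℤ} (h : q + 1 = p) :
    ideal deg p ≤ LinearMap.ker (dMagma f h) := by
  refine Submodule.span_le.2 ?_
  intro x hx
  have hincl : ∀ {p : ℤ} {x : Magma deg p}, Relator x → incl p x = 0 := fun {p x} hx => by
    have : (ideal deg p).mkQ x = 0 :=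
      (Submodule.Quotient.mk_eq_zero _).2 (Submodule.subset_span hx)
    rw [incl, LinearMap.comp_apply, this, map_zero]
  change dMagma f h x = 0
  induction hx generalizing q with
  | @antisymm p q' r u v hu hv h' h'' =>
    rw [map_add, map_smul, dMagma_mul f h' (p' := p - 1) (q' := q' - 1) (by omega) (by omega) h
      (by omega) (by omega), dMagma_mul f h'' (p' := q' - 1) (q' := p - 1) (by omega) (by omega) h
      (by omega) (by omega)]
    exact leibniz_antisymm _ (by omega) (by omega) _ _ _ _ _ _ _ _
  | @jacobi p q' r pq qr rp s u v w hu hv hw hqr hrp hpq h₁ h₂ h₃ =>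
    rw [map_add, map_add, map_smul, map_smul, map_smul,
      dMagma_mul f h₁ (p' := p - 1) (q' := qr - 1) (by omega) (by omega) h (by omega) (by omega),
      dMagma_mul f h₂ (p' := q' - 1) (q' := rp - 1) (by omega) (by omega) h (by omega) (by omega),
      dMagma_mul f h₃ (p' := r - 1) (q' := pq - 1) (by omega) (by omega) h (by omega) (by omega),
      dMagma_mul f hqr (p' := q' - 1) (q' := r - 1) (by omega) (by omega) _ (by omega) (by omega),
      dMagma_mul f hrp (p' := r - 1) (q' := p - 1) (by omega) (by omega) _ (by omega) (by omega),
      dMagma_mul f hpq (p' := p - 1) (q' := q' - 1) (by omega) (by omega) _ (by omega) (by omega)]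
    exact leibniz_jacobi (Complete deg) (p' := p - 1) (q' := q' - 1) (r' := r - 1)
      (pq' := pq - 1) (qr' := qr - 1) (rp' := rp - 1) (s := q)
      (by omega) (by omega) (by omega) hqr hrp hpq (by omega) (by omega) (by omega)
      (by omega) (by omega) (by omega) (by omega) (by omega) (by omega) (by omega) (by omega)
      (by omega) (incl _ (word u hu)) (incl _ (word v hv)) (incl _ (word w hw))
      (dMagma f (by omega) (word u hu)) (dMagma f (by omega) (word v hv))
      (dMagma f (by omega) (word w hw))
  | @mul_left p q' r h' u hu x hx ih =>
    rw [dMagma_mul f h' (p' := p - 1) (q' := q' - 1) (by omega) (by omega) h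
      (by omega) (by omega), hincl hx, ih]
    simp
  | @mul_right p q' r h' x v hv hx ih =>
    rw [dMagma_mul f h' (p' := p - 1) (q' := q' - 1) (by omega) (by omega) h
      (by omega) (by omega), hincl hx, ih]
    simp

/-- The derivation with given values on generators, on the free Lie algebra. -/
def dFree (f : GenValues deg) {p q : ℤ} (h : q + 1 = p) :
    (FreeZGradedLie deg).obj p →ₗ[ℚ] (Complete deg).obj q :=
  (ideal deg p).liftQ (dMagma f h) (dMagma_ideal f h)

theorem dFree_bracket (f : GenValues deg) {p q r p' q' r' : ℤ} (h : p + q = r) (hp : p' + 1 = p)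
    (hq : q' + 1 = q) (hr : r' + 1 = r) (h₁ : p' + q = r') (h₂ : p + q' = r')
    (x : (FreeZGradedLie deg).obj p) (y : (FreeZGradedLie deg).obj q) :
    dFree f hr ((FreeZGradedLie deg).bracket h x y)
      = (Complete deg).bracket h₁ (dFree f hp x) ((FreeZGradedLie deg).toCompletion q y)
      + (-1 : ℚ) ^ p •
        (Complete deg).bracket h₂ ((FreeZGradedLie deg).toCompletion p x) (dFree f hq y) := by
  obtain ⟨x, rfl⟩ := Submodule.mkQ_surjective _ x
  obtain ⟨y, rfl⟩ := Submodule.mkQ_surjective _ y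
  exact dMagma_mul f h hp hq hr h₁ h₂ x y

theorem completion_bracket_left {L : ZGradedLieAlgebra} {p q r : ℤ} (h : p + q = r)
    (s : L.completion.obj p) (t : L.completion.obj q) (n : ℕ) (hs : s.1 n = 0) :
    (L.completion.bracket h s t).1 (n + 1) = 0 := by
  rw [L.completion.antisymm h (by omega)]
  simp [ZGradedLieAlgebra.completion_bracket_right _ t s n hs]

theorem dFree_lcs (f : GenValues deg) (n : ℕ) {p q : ℤ} (h : q + 1 = p)
    (x : (FreeZGradedLie deg).obj p) (hx : x ∈ (FreeZGradedLie deg).lcs n p) :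
    (dFree f h x).1 n = 0 := by
  induction n generalizing p q with
  | zero =>
    obtain ⟨y, hy⟩ := Submodule.mkQ_surjective _ ((dFree f h x).1 0)
    exact hy.symm.trans ((Submodule.Quotient.mk_eq_zero _).2 Submodule.mem_top)
  | succ n ih =>
    refine (Submodule.span_le (p := LinearMap.ker
      (LinearMap.proj (n + 1) ∘ₗ Submodule.subtype _ ∘ₗ dFree f h))).2 ?_ hx
    rintro _ ⟨p', q', h', x, y, hy, rfl⟩
    change (dFree f h ((FreeZGradedLie deg).bracket h' x y)).1 (n + 1) = 0
    rw [dFree_bracket f h' (p' := p' - 1) (q' := q' - 1) (by omega) (by omega) h (by omega)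
      (by omega), Submodule.coe_add, Pi.add_apply, Submodule.coe_smul, Pi.smul_apply,
      ZGradedLieAlgebra.completion_bracket_right _ _ _ n (ih (by omega) y hy),
      ZGradedLieAlgebra.completion_bracket_right _ _ _ n
        ((Submodule.Quotient.mk_eq_zero _).2 hy), smul_zero, add_zero]

/-- The map induced by the derivation on the quotients by the lower central series. -/
def dQuot (f : GenValues deg) {p q : ℤ} (h : q + 1 = p) (n : ℕ) :
    ((FreeZGradedLie deg).obj p ⧸ (FreeZGradedLie deg).lcs n p) →ₗ[ℚ]
      ((FreeZGradedLie deg).obj q ⧸ (FreeZGradedLie deg).lcs n q) :=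
  Submodule.liftQ _ (LinearMap.proj n ∘ₗ Submodule.subtype _ ∘ₗ dFree f h)
    (fun x hx => LinearMap.mem_ker.2 (dFree_lcs f n h x hx))

theorem dQuot_mk (f : GenValues deg) {p q : ℤ} (h : q + 1 = p) (n : ℕ)
    (x : (FreeZGradedLie deg).obj p) :
    dQuot f h n (((FreeZGradedLie deg).lcs n p).mkQ x) = (dFree f h x).1 n := rfl

/-- The derivation of degree `-1` of the completed free Lie algebra that has given values on the
generators and induces, for every `n`, a map `L / Lⁿ → L / Lⁿ` (that is, commutes with infinite
sums). -/
def derivation (f : GenValues deg) : (Complete deg).Derivation where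
  map {p q} h :=
    { toFun := fun s => ⟨fun n => dQuot f h n (s.1 n), fun m n hmn => by
        beta_reduce
        rw [← s.2 m n hmn]
        obtain ⟨x, hx⟩ := Submodule.mkQ_surjective _ (s.1 n)
        rw [← hx, Submodule.factor_mk, dQuot_mk, dQuot_mk]
        exact (dFree f h x).2 m n hmn⟩
      map_add' := fun s t => by ext n; simp
      map_smul' := fun c s => by ext n; simp }
  leibniz {p q r p' q' r'} h hp hq hr h₁ h₂ s t := by
    refine Subtype.ext (funext fun n => ?_)
    obtain ⟨x, hx⟩ := Submodule.mkQ_surjective _ (s.1 n)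
    obtain ⟨y, hy⟩ := Submodule.mkQ_surjective _ (t.1 n)
    have := congrArg (fun s => s.1 n) (dFree_bracket f h hp hq hr h₁ h₂ x y)
    change dQuot f hr n (ZGradedLieAlgebra.quotBracket n h (s.1 n) (t.1 n))
      = ZGradedLieAlgebra.quotBracket n h₁ (dQuot f hp n (s.1 n)) (t.1 n)
        + (-1 : ℚ) ^ p • ZGradedLieAlgebra.quotBracket n h₂ (s.1 n) (dQuot f hq n (t.1 n))
    rw [← hx, ← hy]
    exact this

theorem derivation_gen (f : GenValues deg) (g : X) {p q : ℤ} (h : q + 1 = p) (hg : deg g = p) :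
    (derivation f).map h (gen g hg) = f g q (h.trans hg.symm) := by
  refine Subtype.ext (funext fun n => ?_)
  exact congrArg (fun s => s.1 n) (dMagma_word f h (.of g) hg)

end FreeZGradedLie

/-! ### The Lawrence-Sullivan differential squares to zero -/

namespace ZGradedLieAlgebra

section Finite

variable (L : ZGradedLieAlgebra)

theorem ad_bracket (x : L.obj 0) {p q r : ℤ} (h : p + q = r) (u : L.obj p) (v : L.obj q) :
    L.bracket (zero_add r) x (L.bracket h u v)
      = L.bracket h (L.bracket (zero_add p) x u) v
        + L.bracket h u (L.bracket (zero_add q) x v) := by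
  have J := L.jacobi (p := 0) (q := p) (r := q) h (add_zero q) (zero_add p) (zero_add r) h
    (by omega) x u v
  have e₁ := L.antisymm (add_zero q) (zero_add q) v x
  have e₂ := L.antisymm (p := q) (q := p) (r := r) (by omega) h v
    (L.bracket (zero_add p) x u)
  rw [e₁, e₂] at J
  simp only [zero_mul, mul_zero, zpow_zero, one_smul, map_neg, smul_neg, smul_smul,
    ← mul_zpow, neg_mul_neg, one_mul, one_zpow] at J
  linear_combination (norm := module) J

/-- The terms of the expansion of `∂ adₓⁿ(z)`. -/
def expansionTerm (x : L.obj 0) (y : L.obj (-1)) {p q : ℤ} (h : q + 1 = p) (z : L.obj p) :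
    ℕ → ℕ → L.obj q
  | 0, _ => 0
  | i + 1, j => L.bracket (p := -1) (q := p) (r := q) (by omega)
      ((L.bracket (zero_add (-1)) x ^ i) y) ((L.bracket (zero_add p) x ^ j) z)

variable {L}

theorem derivation_ad (D : L.Derivation) (x : L.obj 0) {p q : ℤ} (h : q + 1 = p) (z : L.obj p) :
    D.map h (L.bracket (zero_add p) x z)
      = L.bracket (p := -1) (q := p) (r := q) (by omega) (D.map (by norm_num) x) z
        + L.bracket (zero_add q) x (D.map h z) := by
  rw [D.leibniz (p' := -1) (q' := q) (r' := q) (zero_add p) (by norm_num) h h (by omega)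
    (zero_add q), zpow_zero, one_smul]

theorem derivation_ad_pow (D : L.Derivation) (x : L.obj 0) {p q : ℤ} (h : q + 1 = p)
    (z : L.obj p) (n : ℕ) :
    D.map h ((L.bracket (zero_add p) x ^ n) z)
      = (L.bracket (zero_add q) x ^ n) (D.map h z)
        + ∑ ij ∈ Finset.HasAntidiagonal.antidiagonal n, n.choose ij.1 •
          L.expansionTerm x (D.map (by norm_num) x) h z ij.1 ij.2 := by
  induction n with
  | zero => simp [expansionTerm]
  | succ n ih =>
    rw [pow_succ', Module.End.mul_apply, derivation_ad, ih, map_add, pow_succ',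
      Module.End.mul_apply, Finset.sum_antidiagonal_choose_succ_nsmul, map_sum]
    have key : ∀ ij ∈ Finset.HasAntidiagonal.antidiagonal n,
        L.bracket (zero_add q) x (n.choose ij.1 •
          L.expansionTerm x (D.map (by norm_num) x) h z ij.1 ij.2)
        = n.choose ij.1 • L.expansionTerm x (D.map (by norm_num) x) h z ij.1 (ij.2 + 1)
          + n.choose ij.2 • L.expansionTerm x (D.map (by norm_num) x) h z (ij.1 + 1) ij.2
          - if ij.1 = 0 then L.expansionTerm x (D.map (by norm_num) x) h z 1 n else 0 := by
      rintro ⟨i, j⟩ hij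
      rw [Finset.HasAntidiagonal.mem_antidiagonal] at hij
      simp only at hij ⊢
      have hc : n.choose i = n.choose j := by
        subst hij; exact Nat.choose_symm_add
      rw [← hc, map_nsmul]
      cases i with
      | zero =>
        obtain rfl : j = n := by omega
        simp [expansionTerm]
      | succ i =>
        simp only [expansionTerm]
        rw [ad_bracket, pow_succ' _ i, pow_succ' _ j, Module.End.mul_apply, Module.End.mul_apply]
        rw [if_neg (by omega), sub_zero, smul_add, add_comm]
    rw [Finset.sum_congr rfl key, Finset.sum_sub_distrib, Finset.sum_add_distrib]
    have : ∑ ij ∈ Finset.HasAntidiagonal.antidiagonal n,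
        (if ij.1 = 0 then L.expansionTerm x (D.map (by norm_num) x) h z 1 n else 0)
        = L.expansionTerm x (D.map (by norm_num) x) h z 1 n := by
      rw [Finset.Nat.sum_antidiagonal_eq_sum_range_succ_mk]
      simp
    have e : L.bracket (p := -1) (q := p) (r := q) (by omega) (D.map (by norm_num) x)
        ((L.bracket (zero_add p) x ^ n) z)
        = L.expansionTerm x (D.map (by norm_num) x) h z 1 n := rfl
    rw [this, e]
    abel

end Finite

end ZGradedLieAlgebra

namespace ZGradedLieAlgebra

open Finset.HasAntidiagonal in
theorem sum_antidiagonal_eq_of_vanish {V : Type} [AddCommGroup V] (F : ℕ → ℕ → V) (N M : ℕ)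
    (hM : 2 * N + 2 ≤ M) (h₁ : ∀ i j, N < i → F i j = 0) (h₂ : ∀ i j, N < j → F i j = 0) :
    ∑ m ∈ Finset.range M, ∑ ij ∈ antidiagonal m, F ij.1 ij.2
      = ∑ i ∈ Finset.range (N + 1), ∑ j ∈ Finset.range (N + 1), F i j := by
  simp only [Finset.Nat.sum_antidiagonal_eq_sum_range_succ_mk]
  rw [Finset.sum_range_diag_flip M F]
  symm
  rw [← Finset.sum_subset (s₁ := Finset.range (N + 1)) (s₂ := Finset.range M)]
  · refine Finset.sum_congr rfl fun i hi => ?_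
    refine Finset.sum_subset ?_ fun j _ hj => h₂ i j ?_
    · intro j hj
      simp only [Finset.mem_range] at hi hj ⊢
      omega
    · simpa using hj
  · intro j hj
    simp only [Finset.mem_range] at hj ⊢
    omega
  · intro i _ hi
    exact Finset.sum_eq_zero fun j _ => h₁ i j (by simpa using hi)

section Series

variable {K : ZGradedLieAlgebra}

/-- The class modulo the lower central series, as a linear map. -/
def level (N : ℕ) {p : ℤ} : K.completion.obj p →ₗ[ℚ] K.obj p ⧸ K.lcs N p :=
  LinearMap.proj N ∘ₗ Submodule.subtype _

theorem level_ext {p : ℤ} {s t : K.completion.obj p} (h : ∀ N, level N s = level N t) : s = t :=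
  Subtype.ext (funext h)

theorem level_bracket_congr (N : ℕ) {p q r : ℤ} (h : p + q = r) {s s' : K.completion.obj p}
    {t t' : K.completion.obj q} (hs : level N s = level N s') (ht : level N t = level N t') :
    level N (K.completion.bracket h s t) = level N (K.completion.bracket h s' t') := by
  change quotBracket N h (level N s) (level N t) = quotBracket N h (level N s') (level N t')
  rw [hs, ht]

theorem level_bracket_zero_left (N : ℕ) {p q r : ℤ} (h : p + q = r) {s : K.completion.obj p}
    (t : K.completion.obj q) (hs : level N s = 0) :
    level N (K.completion.bracket h s t) = 0 := by
  rw [level_bracket_congr (s' := 0) N h (by simpa using hs) rfl]; simp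

theorem level_bracket_zero_right (N : ℕ) {p q r : ℤ} (h : p + q = r) (s : K.completion.obj p)
    {t : K.completion.obj q} (ht : level N t = 0) :
    level N (K.completion.bracket h s t) = 0 := by
  rw [level_bracket_congr (t' := 0) N h rfl (by simpa using ht)]; simp

theorem level_ad_pow (x : K.completion.obj 0) {p : ℤ} (z : K.completion.obj p) {k N : ℕ}
    (h : N ≤ k) : level N ((K.completion.bracket (zero_add p) x ^ k) z) = 0 :=
  ad_pow_eq_zero x z k N h

theorem level_ad_pow_congr (N : ℕ) (x : K.completion.obj 0) {p : ℤ} {s t : K.completion.obj p}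
    (h : level N s = level N t) (k : ℕ) :
    level N ((K.completion.bracket (zero_add p) x ^ k) s)
      = level N ((K.completion.bracket (zero_add p) x ^ k) t) := by
  induction k with
  | zero => exact h
  | succ k ih =>
    rw [pow_succ', Module.End.mul_apply, Module.End.mul_apply]
    exact level_bracket_congr N _ rfl ih

theorem level_adSeries {p : ℤ} (c : ℕ → ℚ) (x : K.completion.obj 0) (z : K.completion.obj p)
    {N M : ℕ} (h : N ≤ M) :
    level N (adSeries c x z)
      = level N (∑ k ∈ Finset.range M, c k • (K.completion.bracket (zero_add p) x ^ k) z) :=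
  (adSeries_partial c x z h).symm

theorem adSeries_sub {p : ℤ} (c : ℕ → ℚ) (x : K.completion.obj 0) (z w : K.completion.obj p) :
    adSeries c x (z - w) = adSeries c x z - adSeries c x w := by
  refine level_ext fun N => ?_
  rw [map_sub, level_adSeries c x _ le_rfl, level_adSeries c x _ le_rfl,
    level_adSeries c x _ le_rfl, ← map_sub]
  simp [smul_sub]

theorem adSeries_add {p : ℤ} (c : ℕ → ℚ) (x : K.completion.obj 0) (z w : K.completion.obj p) :
    adSeries c x (z + w) = adSeries c x z + adSeries c x w := by
  refine level_ext fun N => ?_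
  rw [map_add, level_adSeries c x _ le_rfl, level_adSeries c x _ le_rfl,
    level_adSeries c x _ le_rfl, ← map_add]
  simp [smul_add, Finset.sum_add_distrib]

theorem adSeries_zero {p : ℤ} (c : ℕ → ℚ) (x : K.completion.obj 0) :
    adSeries c x (0 : K.completion.obj p) = 0 := by
  have := adSeries_sub c x (0 : K.completion.obj p) 0
  simpa using this

theorem adSeries_mul {p : ℤ} (f g : PowerSeries ℚ) (x : K.completion.obj 0)
    (z : K.completion.obj p) :
    adSeries (fun n => PowerSeries.coeff n (f * g)) x z
      = adSeries (fun n => PowerSeries.coeff n f) x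
        (adSeries (fun n => PowerSeries.coeff n g) x z) := by
  refine level_ext fun N => ?_
  rw [level_adSeries _ x z (show N ≤ 2 * N + 2 by omega),
    level_adSeries _ x _ (show N ≤ N + 1 by omega), map_sum, map_sum]
  have e : ∀ i ∈ Finset.range (N + 1),
      level N (PowerSeries.coeff i f • (K.completion.bracket (zero_add p) x ^ i)
        (adSeries (fun n => PowerSeries.coeff n g) x z))
      = ∑ j ∈ Finset.range (N + 1), (PowerSeries.coeff i f * PowerSeries.coeff j g) •
          level N ((K.completion.bracket (zero_add p) x ^ (i + j)) z) := by
    intro i _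
    rw [map_smul, level_ad_pow_congr N x (level_adSeries _ x z (show N ≤ N + 1 by omega)),
      map_sum, map_sum, Finset.smul_sum]
    refine Finset.sum_congr rfl fun j _ => ?_
    rw [map_smul, map_smul, smul_smul, pow_add, Module.End.mul_apply]
  rw [Finset.sum_congr rfl e, ← sum_antidiagonal_eq_of_vanish
    (fun i j => (PowerSeries.coeff i f * PowerSeries.coeff j g) •
      level N ((K.completion.bracket (zero_add p) x ^ (i + j)) z)) N (2 * N + 2) le_rfl]
  · refine Finset.sum_congr rfl fun m _ => ?_
    rw [PowerSeries.coeff_mul, map_smul, Finset.sum_smul]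
    refine Finset.sum_congr rfl fun ij hij => ?_
    rw [Finset.HasAntidiagonal.mem_antidiagonal.1 hij]
  · intro i j hi
    rw [level_ad_pow x z (by omega), smul_zero]
  · intro i j hj
    rw [level_ad_pow x z (by omega), smul_zero]

theorem adSeries_one {p : ℤ} (x : K.completion.obj 0) (z : K.completion.obj p) :
    adSeries (fun n => PowerSeries.coeff n (1 : PowerSeries ℚ)) x z = z := by
  refine level_ext fun N => ?_
  rw [level_adSeries _ x z (show N ≤ N + 1 by omega), Finset.sum_eq_single 0]
  · simp
  · intro k _ hk
    simp [PowerSeries.coeff_one, hk]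
  · simp

theorem adSeries_X {p : ℤ} (x : K.completion.obj 0) (z : K.completion.obj p) :
    adSeries (fun n => PowerSeries.coeff n (PowerSeries.X : PowerSeries ℚ)) x z
      = K.completion.bracket (zero_add p) x z := by
  refine level_ext fun N => ?_
  rw [level_adSeries _ x z (show N ≤ N + 2 by omega), Finset.sum_eq_single 1]
  · simp
  · intro k _ hk
    simp [PowerSeries.coeff_X, hk]
  · simp

theorem adSeries_sub_coeff {p : ℤ} (c d : ℕ → ℚ) (x : K.completion.obj 0)
    (z : K.completion.obj p) :
    adSeries (fun n => c n - d n) x z = adSeries c x z - adSeries d x z := by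
  refine level_ext fun N => ?_
  rw [map_sub, level_adSeries _ x z le_rfl, level_adSeries c x _ le_rfl,
    level_adSeries d x _ le_rfl, ← map_sub]
  simp [sub_smul]

/-- The coefficients of `(eᵗ - 1) / t`. -/
def expDiv (n : ℕ) : ℚ := 1 / (n + 1).factorial

/-- The coefficients of `eᵗ`. -/
def expCoeff (n : ℕ) : ℚ := 1 / n.factorial

theorem level_expansionTerm_left (x : K.completion.obj 0) (y : K.completion.obj (-1)) {p q : ℤ}
    (h : q + 1 = p) (z : K.completion.obj p) (N i j : ℕ) (hi : N < i) :
    level N (K.completion.expansionTerm x y h z i j) = 0 := by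
  obtain ⟨i, rfl⟩ := Nat.exists_eq_succ_of_ne_zero (show i ≠ 0 by omega)
  exact level_bracket_zero_left N _ _ (level_ad_pow x y (by omega))

theorem level_expansionTerm_right (x : K.completion.obj 0) (y : K.completion.obj (-1)) {p q : ℤ}
    (h : q + 1 = p) (z : K.completion.obj p) (N i j : ℕ) (hj : N < j) :
    level N (K.completion.expansionTerm x y h z i j) = 0 := by
  cases i with
  | zero => simp [expansionTerm]
  | succ i => exact level_bracket_zero_right N _ _ (level_ad_pow x z (by omega))

end Series

end ZGradedLieAlgebra

namespace ZGradedLieAlgebra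

section Square

variable {K : ZGradedLieAlgebra}

/-- A derivation that is compatible with the projective limit. -/
def Derivation.IsContinuous (D : K.completion.Derivation) : Prop :=
  ∀ ⦃p q : ℤ⦄ (h : q + 1 = p) (N : ℕ) (s t : K.completion.obj p),
    level N s = level N t → level N (D.map h s) = level N (D.map h t)

theorem level_bracket_series (x : K.completion.obj 0) (y : K.completion.obj (-1)) {p q : ℤ}
    (h : q + 1 = p) (h' : -1 + p = q) (z : K.completion.obj p) (d : ℕ → ℚ) (N : ℕ) :
    level N (K.completion.bracket h' (adSeries expDiv x y) (adSeries d x z))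
      = ∑ i ∈ Finset.range (N + 1), ∑ j ∈ Finset.range (N + 1), (expCoeff i * d j) •
        level N (K.completion.expansionTerm x y h z i j) := by
  rw [level_bracket_congr N h' (level_adSeries expDiv x y le_rfl)
    (level_adSeries d x z (Nat.le_succ N)), map_sum (K.completion.bracket h'),
    LinearMap.sum_apply, map_sum (level N),
    Finset.sum_range_succ' (fun i => ∑ j ∈ Finset.range (N + 1), (expCoeff i * d j) •
        level N (K.completion.expansionTerm x y h z i j)) N]
  have : ∑ j ∈ Finset.range (N + 1), (expCoeff 0 * d j) •
        level N (K.completion.expansionTerm x y h z 0 j) = 0 := by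
    simp [expansionTerm]
  rw [this, add_zero]
  refine Finset.sum_congr rfl fun i _ => ?_
  rw [map_sum, map_sum]
  refine Finset.sum_congr rfl fun j _ => ?_
  rw [map_smul, map_smul, map_smul (K.completion.bracket h'), LinearMap.smul_apply, map_smul,
    smul_smul, mul_comm (d j)]
  rfl

theorem choose_div_factorial (i j : ℕ) :
    expCoeff (i + j) * ((i + j).choose i : ℚ) = expCoeff i * expCoeff j := by
  unfold expCoeff
  have h := Nat.add_choose_mul_factorial_mul_factorial j i
  rw [add_comm j i] at h
  have h' : (((i + j).choose i : ℕ) : ℚ) * j.factorial * i.factorial = (i + j).factorial := by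
    exact_mod_cast h
  have h₁ : (i.factorial : ℚ) ≠ 0 := by exact_mod_cast i.factorial_ne_zero
  have h₂ : (j.factorial : ℚ) ≠ 0 := by exact_mod_cast j.factorial_ne_zero
  rw [← h']
  have h₃ : (((i + j).choose i : ℕ) : ℚ) ≠ 0 := by
    exact_mod_cast (Nat.choose_pos (Nat.le_add_right i j)).ne'
  field_simp

theorem level_derivation_adSeries (D : K.completion.Derivation) (hD : D.IsContinuous)
    (x : K.completion.obj 0) {p q : ℤ} (h : q + 1 = p) (z : K.completion.obj p) (c : ℕ → ℚ)
    {N M : ℕ} (hM : N ≤ M) :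
    level N (D.map h (adSeries c x z)) = level N (adSeries c x (D.map h z))
      + ∑ m ∈ Finset.range M, ∑ ij ∈ Finset.HasAntidiagonal.antidiagonal m,
          (c m * (m.choose ij.1 : ℚ)) • level N
            (K.completion.expansionTerm x (D.map (by norm_num) x) h z ij.1 ij.2) := by
  rw [hD h N _ _ (level_adSeries c x z hM), level_adSeries c x (D.map h z) hM, map_sum, map_sum,
    map_sum, ← Finset.sum_add_distrib]
  refine Finset.sum_congr rfl fun m _ => ?_
  rw [map_smul, derivation_ad_pow, smul_add, map_add, map_smul, map_smul]
  congr 1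
  rw [map_sum, Finset.smul_sum]
  refine Finset.sum_congr rfl fun ij _ => ?_
  rw [map_nsmul, ← Nat.cast_smul_eq_nsmul ℚ, smul_smul]

theorem derivation_exp (D : K.completion.Derivation) (hD : D.IsContinuous)
    (x : K.completion.obj 0) {p q : ℤ} (h : q + 1 = p) (h' : -1 + p = q)
    (z : K.completion.obj p) :
    D.map h (adSeries expCoeff x z) = adSeries expCoeff x (D.map h z)
      + K.completion.bracket h' (adSeries expDiv x (D.map (by norm_num) x))
          (adSeries expCoeff x z) := by
  refine level_ext fun N => ?_
  rw [map_add, level_derivation_adSeries D hD x h z expCoeff (show N ≤ 2 * N + 2 by omega),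
    level_bracket_series x _ h h' z, ← sum_antidiagonal_eq_of_vanish
      (fun i j => (expCoeff i * expCoeff j) • level N
        (K.completion.expansionTerm x (D.map (by norm_num) x) h z i j)) N (2 * N + 2) le_rfl]
  · congr 1
    refine Finset.sum_congr rfl fun m _ => Finset.sum_congr rfl fun ij hij => ?_
    rw [← Finset.HasAntidiagonal.mem_antidiagonal.1 hij, choose_div_factorial]
  · intro i j hi
    rw [level_expansionTerm_left _ _ _ _ _ _ _ hi, smul_zero]
  · intro i j hj
    rw [level_expansionTerm_right _ _ _ _ _ _ _ hj, smul_zero]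

/-- The brackets `[adₓⁱ⁻¹ y, adₓʲ⁻¹ y]`, for `y` of degree `-1`. -/
def symTerm (x : K.completion.obj 0) (y : K.completion.obj (-1)) (i : ℕ) :
    ℕ → K.completion.obj (-2)
  | 0 => 0
  | j + 1 => K.completion.expansionTerm x y (p := -1) (by norm_num) y i j

theorem symTerm_comm (x : K.completion.obj 0) (y : K.completion.obj (-1)) (i j : ℕ) :
    symTerm x y i j = symTerm x y j i := by
  cases i with
  | zero => cases j <;> simp [symTerm, expansionTerm]
  | succ i =>
    cases j with
    | zero => simp [symTerm, expansionTerm]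
    | succ j =>
      simp only [symTerm, expansionTerm]
      rw [K.completion.antisymm (p := -1) (q := -1) (r := -2) (by norm_num) (by norm_num)]
      norm_num

theorem sum_symTerm (x : K.completion.obj 0) (y : K.completion.obj (-1)) (N m : ℕ) :
    ∑ ij ∈ Finset.HasAntidiagonal.antidiagonal m, (expDiv m * (m.choose ij.1 : ℚ)) • level N
            (K.completion.expansionTerm x y (p := -1) (q := -2) (by norm_num) y ij.1 ij.2)
      = (1 / 2 : ℚ) • ∑ ij ∈ Finset.HasAntidiagonal.antidiagonal (m + 1),
          (expCoeff ij.1 * expCoeff ij.2) • level N (symTerm x y ij.1 ij.2) := by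
  have h := Finset.sum_antidiagonal_choose_succ_nsmul
    (fun i j => level N (symTerm x y i j)) m
  have hswap : ∑ ij ∈ Finset.HasAntidiagonal.antidiagonal m,
      m.choose ij.2 • level N (symTerm x y (ij.1 + 1) ij.2)
      = ∑ ij ∈ Finset.HasAntidiagonal.antidiagonal m,
        m.choose ij.1 • level N (symTerm x y ij.1 (ij.2 + 1)) := by
    rw [← Finset.Nat.sum_antidiagonal_swap]
    refine Finset.sum_congr rfl fun ij _ => ?_
    rw [symTerm_comm]
    rfl
  rw [hswap] at h
  have e₁ : ∑ ij ∈ Finset.HasAntidiagonal.antidiagonal (m + 1),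
      (expCoeff ij.1 * expCoeff ij.2) • level N (symTerm x y ij.1 ij.2)
      = expDiv m • ∑ ij ∈ Finset.HasAntidiagonal.antidiagonal (m + 1),
        (m + 1).choose ij.1 • level N (symTerm x y ij.1 ij.2) := by
    rw [Finset.smul_sum]
    refine Finset.sum_congr rfl fun ij hij => ?_
    have hm := Finset.HasAntidiagonal.mem_antidiagonal.1 hij
    rw [← choose_div_factorial, hm, ← Nat.cast_smul_eq_nsmul ℚ, smul_smul]
    rfl
  have e₂ : ∑ ij ∈ Finset.HasAntidiagonal.antidiagonal m, (expDiv m * (m.choose ij.1 : ℚ)) •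
      level N (K.completion.expansionTerm x y (p := -1) (q := -2) (by norm_num) y ij.1 ij.2)
      = expDiv m • ∑ ij ∈ Finset.HasAntidiagonal.antidiagonal m,
        m.choose ij.1 • level N (symTerm x y ij.1 (ij.2 + 1)) := by
    rw [Finset.smul_sum]
    refine Finset.sum_congr rfl fun ij _ => ?_
    rw [← Nat.cast_smul_eq_nsmul ℚ, smul_smul]
    rfl
  rw [e₁, e₂, h]
  module

theorem derivation_expDiv (D : K.completion.Derivation) (hD : D.IsContinuous)
    (x : K.completion.obj 0) (y : K.completion.obj (-1)) (hy : D.map (by norm_num) x = y) :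
    D.map (p := -1) (q := -2) (by norm_num) (adSeries expDiv x y)
      = adSeries expDiv x (D.map (by norm_num) y)
      + (1 / 2 : ℚ) • K.completion.bracket (p := -1) (q := -1) (by norm_num)
          (adSeries expDiv x y) (adSeries expDiv x y) := by
  refine level_ext fun N => ?_
  rw [map_add, level_derivation_adSeries D hD x _ y expDiv (show N ≤ 2 * N + 2 by omega),
    map_smul, level_bracket_series x y (p := -1) (q := -2) (by norm_num) (by norm_num) y]
  simp only [hy, sum_symTerm]
  rw [← Finset.smul_sum]
  congr 2
  have h₀ : ∑ ij ∈ Finset.HasAntidiagonal.antidiagonal 0,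
      (expCoeff ij.1 * expCoeff ij.2) • level N (symTerm x y ij.1 ij.2) = 0 := by
    simp [symTerm]
  have := Finset.sum_range_succ' (fun m => ∑ ij ∈ Finset.HasAntidiagonal.antidiagonal m,
      (expCoeff ij.1 * expCoeff ij.2) • level N (symTerm x y ij.1 ij.2)) (2 * N + 2)
  rw [h₀, add_zero] at this
  have hl : ∀ i j, N < i → level N (symTerm x y i j) = 0 := by
    intro i j hi
    cases j with
    | zero => simp [symTerm]
    | succ j => exact level_expansionTerm_left _ _ (by norm_num) _ _ _ _ hi
  rw [← this, sum_antidiagonal_eq_of_vanish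
    (fun i j => (expCoeff i * expCoeff j) • level N (symTerm x y i j)) N (2 * N + 2 + 1)
    (by omega) (fun i j hi => by rw [hl i j hi, smul_zero])
    (fun i j hj => by rw [symTerm_comm, hl j i hj, smul_zero])]
  refine Finset.sum_congr rfl fun i _ => ?_
  rw [Finset.sum_range_succ', Finset.sum_range_succ (n := N)]
  have h₁ : level N (symTerm x y i 0) = 0 := by simp [symTerm]
  have h₂ : level N (K.completion.expansionTerm x y (p := -1) (q := -2) (by norm_num) y i N)
      = 0 := by
    cases i with
    | zero => simp [expansionTerm]
    | succ i => exact level_bracket_zero_right N _ _ (level_ad_pow x y le_rfl)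
  rw [h₁, h₂, smul_zero, smul_zero]
  rfl

/-- The coefficients `Bₙ / n!` of `t / (eᵗ - 1)`, so `B₁ = -1/2`. -/
def bernoulliCoeff (n : ℕ) : ℚ := bernoulli n / n.factorial

theorem series_identities :
    (PowerSeries.mk bernoulliCoeff) * (PowerSeries.mk expDiv) = 1 ∧
    (PowerSeries.mk expDiv) * PowerSeries.X = PowerSeries.mk expCoeff - 1 := by
  have h₂ : (PowerSeries.mk expDiv) * PowerSeries.X = PowerSeries.mk expCoeff - 1 := by
    ext n
    cases n with
    | zero => simp [expCoeff]
    | succ n => simp [PowerSeries.coeff_succ_mul_X, expDiv, expCoeff, PowerSeries.coeff_one]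
  refine ⟨?_, h₂⟩
  have h := bernoulliPowerSeries_mul_exp_sub_one ℚ
  have e₁ : bernoulliPowerSeries ℚ = PowerSeries.mk bernoulliCoeff := by
    ext n; simp [bernoulliPowerSeries, bernoulliCoeff]
  have e₂ : PowerSeries.exp ℚ = PowerSeries.mk expCoeff := by
    ext n; simp [PowerSeries.coeff_exp, expCoeff]
  rw [e₁, e₂, ← h₂, ← mul_assoc] at h
  have hX : (PowerSeries.X : PowerSeries ℚ) ≠ 0 := PowerSeries.X_ne_zero
  exact mul_right_cancel₀ hX (by rw [h, one_mul])

theorem adSeries_mk {p : ℤ} (c : ℕ → ℚ) (x : K.completion.obj 0) (z : K.completion.obj p) :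
    adSeries c x z = adSeries (fun n => PowerSeries.coeff n (PowerSeries.mk c)) x z := by
  simp only [PowerSeries.coeff_mk]

theorem expDiv_bernoulli {p : ℤ} (x : K.completion.obj 0) (z : K.completion.obj p) :
    adSeries expDiv x (adSeries bernoulliCoeff x z) = z := by
  rw [adSeries_mk, adSeries_mk bernoulliCoeff, ← adSeries_mul, mul_comm,
    series_identities.1, adSeries_one]

theorem bernoulli_expDiv {p : ℤ} (x : K.completion.obj 0) (z : K.completion.obj p) :
    adSeries bernoulliCoeff x (adSeries expDiv x z) = z := by
  rw [adSeries_mk, adSeries_mk expDiv, ← adSeries_mul, series_identities.1, adSeries_one]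

theorem expDiv_ad {p : ℤ} (x : K.completion.obj 0) (z : K.completion.obj p) :
    adSeries expDiv x (K.completion.bracket (zero_add p) x z) = adSeries expCoeff x z - z := by
  rw [adSeries_mk, ← adSeries_X, ← adSeries_mul, series_identities.2]
  simp only [map_sub]
  rw [adSeries_sub_coeff, adSeries_one, ← adSeries_mk]

/-- The inner derivation `[b, -]`, for `b` of degree `-1`. -/
def innerDerivation (L : ZGradedLieAlgebra) (b : L.obj (-1)) : L.Derivation where
  map h := L.bracket (by omega) b
  leibniz {p q r p' q' r'} h hp hq hr h₁ h₂ u v := by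
    have J := L.jacobi (p := -1) (q := p) (r := q) (pq := p') (qr := r) (rp := q') (s := r')
      h (by omega) (by omega) (by omega) (by omega) (by omega) b u v
    rw [L.antisymm (p := q) (q := -1) (r := q') (by omega) (by omega) v b,
      L.antisymm (p := q) (q := p') (r := r') (by omega) (by omega) v] at J
    have s : ∀ n : ℤ, (-1 : ℚ) ^ n = if Even n then 1 else -1 := fun n => by
      split_ifs with h
      · exact h.neg_one_zpow
      · exact (Int.not_even_iff_odd.1 h).neg_one_zpow
    have hm : ¬ Even (-1 : ℤ) := by decide
    obtain rfl : p' = p - 1 := by omega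
    simp only [s, map_neg, map_smul, Int.even_mul, Int.even_sub, hm, Int.not_even_one] at J ⊢
    generalize L.bracket (p := -1) (q := r) (r := r') (by omega) b (L.bracket h u v) = α at *
    generalize L.bracket (p := p - 1) (q := q) (r := r') (by omega)
      (L.bracket (p := -1) (q := p) (r := p - 1) (by omega) b u) v = β at *
    generalize L.bracket (p := p) (q := q') (r := r') (by omega) u
      (L.bracket (p := -1) (q := q) (r := q') (by omega) b v) = γ at *
    by_cases hpe : Even p <;> by_cases hqe : Even q <;>
      simp only [hpe, hqe, if_true, if_false, or_true, or_self, not_true,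
        iff_false, or_false] at J ⊢ <;>
      first
      | linear_combination (norm := module) J
      | linear_combination (norm := module) (-1 : ℚ) • J

theorem innerDerivation_isContinuous (b : K.completion.obj (-1)) :
    (innerDerivation K.completion b).IsContinuous :=
  fun _ _ _ N _ _ hst => level_bracket_congr N _ rfl hst

theorem adSeries_smul {p : ℤ} (c : ℕ → ℚ) (x : K.completion.obj 0) (k : ℚ)
    (z : K.completion.obj p) : adSeries c x (k • z) = k • adSeries c x z := by
  refine level_ext fun N => ?_
  rw [map_smul, level_adSeries c x _ le_rfl, level_adSeries c x _ le_rfl, ← map_smul]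
  simp [Finset.smul_sum, smul_comm k]

/-- The exponential of `adₓ` is an automorphism (used for a first factor of degree `-1`). -/
theorem exp_bracket (x : K.completion.obj 0) (b : K.completion.obj (-1)) {p q : ℤ}
    (h : -1 + p = q) (z : K.completion.obj p) :
    adSeries expCoeff x (K.completion.bracket h b z)
      = K.completion.bracket h (adSeries expCoeff x b) (adSeries expCoeff x z) := by
  have H := derivation_exp (innerDerivation K.completion b) (innerDerivation_isContinuous b) x
    (p := p) (q := q) (by omega) h z
  have e : (innerDerivation K.completion b).map (p := 0) (q := -1) (by norm_num) x
      = 0 - K.completion.bracket (zero_add (-1)) x b := by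
    rw [zero_sub]
    change K.completion.bracket _ b x = _
    rw [K.completion.antisymm (add_zero (-1)) (zero_add (-1))]
    simp
  rw [e, adSeries_sub, adSeries_zero, expDiv_ad] at H
  change K.completion.bracket h b (adSeries expCoeff x z)
    = adSeries expCoeff x (K.completion.bracket h b z) + _ at H
  simp only [map_sub, LinearMap.sub_apply, map_zero, LinearMap.zero_apply] at H
  linear_combination (norm := module) (-1 : ℚ) • H

theorem derivation_sq_odd (L : ZGradedLieAlgebra) (D : L.Derivation) (a : L.obj (-1))
    (ha : D.map (p := -1) (q := -2) (by norm_num) a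
      = (-(1 / 2) : ℚ) • L.bracket (p := -1) (q := -1) (by norm_num) a a) :
    D.map (p := -2) (q := -3) (by norm_num) (D.map (p := -1) (q := -2) (by norm_num) a) = 0 := by
  have J := L.jacobi (p := -1) (q := -1) (r := -1) (pq := -2) (qr := -2) (rp := -2) (s := -3)
    (by norm_num) (by norm_num) (by norm_num) (by norm_num) (by norm_num) (by norm_num) a a a
  have S := L.antisymm (p := -2) (q := -1) (r := -3) (by norm_num) (by norm_num)
    (L.bracket (p := -1) (q := -1) (r := -2) (by norm_num) a a) a
  rw [ha, map_smul, D.leibniz (p := -1) (q := -1) (r := -2) (p' := -2) (q' := -2)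
    (r' := -3) (by norm_num) (by norm_num) (by norm_num) (by norm_num) (by norm_num)
    (by norm_num), ha]
  simp only [map_smul, LinearMap.smul_apply, S]
  norm_num at J ⊢
  generalize L.bracket (p := -1) (q := -2) (r := -3) (by norm_num) a
    (L.bracket (p := -1) (q := -1) (r := -2) (by norm_num) a a) = t at *
  have : t = 0 := by linear_combination (norm := module) (-(1 : ℚ) / 3) • J
  simp [this]

theorem derivation_sq_x (D : K.completion.Derivation) (hD : D.IsContinuous)
    (a b : K.completion.obj (-1)) (x : K.completion.obj 0)
    (ha : D.map (p := -1) (q := -2) (by norm_num) a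
      = (-(1 / 2) : ℚ) • K.completion.bracket (p := -1) (q := -1) (by norm_num) a a)
    (hb : D.map (p := -1) (q := -2) (by norm_num) b
      = (-(1 / 2) : ℚ) • K.completion.bracket (p := -1) (q := -1) (by norm_num) b b)
    (hx : D.map (p := 0) (q := -1) (by norm_num) x
      = K.completion.bracket (zero_add (-1)) x b + adSeries bernoulliCoeff x (b - a)) :
    D.map (p := -1) (q := -2) (by norm_num) (D.map (p := 0) (q := -1) (by norm_num) x) = 0 := by
  generalize hy : D.map (p := 0) (q := -1) (by norm_num) x = y at hx ⊢
  have hE : adSeries expDiv x y = adSeries expCoeff x b - a := by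
    rw [hx, adSeries_add, expDiv_ad, expDiv_bernoulli]; abel
  have h₁ := derivation_expDiv D hD x y hy
  have h₂ := derivation_exp D hD x (p := -1) (q := -2) (by norm_num) (by norm_num) b
  rw [hb, adSeries_smul, exp_bracket, hy, hE] at h₂
  rw [hE, map_sub, h₂, ha] at h₁
  have S := K.completion.antisymm (p := -1) (q := -1) (r := -2) (by norm_num) (by norm_num)
    (adSeries expCoeff x b) a
  simp only [map_sub, LinearMap.sub_apply] at h₁
  norm_num at S
  rw [S] at h₁
  have h₄ : adSeries expDiv x (D.map (p := -1) (q := -2) (by norm_num) y) = 0 := by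
    linear_combination (norm := module) (-1 : ℚ) • h₁
  rw [← bernoulli_expDiv x (D.map (p := -1) (q := -2) (by norm_num) y), h₄, adSeries_zero]

end Square

end ZGradedLieAlgebra

namespace FreeZGradedLie

variable {X : Type} {deg : X → ℤ}

theorem derivation_incl (f : GenValues deg) {p q : ℤ} (h : q + 1 = p) (x : Magma deg p) :
    (derivation f).map h (incl p x) = dMagma f h x := rfl

theorem derivation_isContinuous (f : GenValues deg) : (derivation f).IsContinuous := by
  intro p q h N s t hst
  change dQuot f h N (s.1 N) = dQuot f h N (t.1 N)
  exact congrArg _ hst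

theorem derivation_sq_word (f : GenValues deg)
    (hf : ∀ (g : X) (q r : ℤ) (hr : r + 1 = q) (hq : q + 1 = deg g),
      (derivation f).map hr (f g q hq) = 0) (w : FreeMagma X) (q r : ℤ) (hr : r + 1 = q)
    (hq : q + 1 = wordDeg deg w) : (derivation f).map hr (dWord f w q hq) = 0 := by
  induction w using FreeMagma.rec generalizing q r with
  | of g => exact hf g q r hr hq
  | mul u v ihu ihv =>
    have hq' : q + 1 = wordDeg deg u + wordDeg deg v := hq
    rw [dWord, map_add, map_smul,
      (derivation f).leibniz (p := wordDeg deg u - 1) (q := wordDeg deg v) (r := q)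
        (p' := wordDeg deg u - 2) (q' := wordDeg deg v - 1) (r' := r)
        (by omega) (by omega) (by omega) hr (by omega) (by omega),
      (derivation f).leibniz (p := wordDeg deg u) (q := wordDeg deg v - 1) (r := q)
        (p' := wordDeg deg u - 1) (q' := wordDeg deg v - 2) (r' := r)
        (by omega) (by omega) (by omega) hr (by omega) (by omega),
      ihu, ihv, derivation_incl, derivation_incl, dMagma_word, dMagma_word]
    simp only [map_zero, LinearMap.zero_apply, zero_add, smul_zero, add_zero]
    rw [← add_smul, zpow_sub_one₀ (by norm_num)]
    norm_num

theorem derivation_sq (f : GenValues deg)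
    (hf : ∀ (g : X) (q r : ℤ) (hr : r + 1 = q) (hq : q + 1 = deg g),
      (derivation f).map hr (f g q hq) = 0) {p q r : ℤ} (hp : q + 1 = p) (hq : r + 1 = q)
    (s : (Complete deg).obj p) : (derivation f).map hq ((derivation f).map hp s) = 0 := by
  have key : ∀ x : Magma deg p, (derivation f).map hq (dMagma f hp x) = 0 := by
    intro x
    induction x using magma_induction with
    | zero => simp
    | add x y hx hy => rw [map_add, map_add, hx, hy, add_zero]
    | smul c x hx => rw [map_smul, map_smul, hx, smul_zero]
    | word w hw =>
      rw [dMagma_word]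
      exact derivation_sq_word f hf w q r hq _
  refine ZGradedLieAlgebra.level_ext fun N => ?_
  obtain ⟨x, hx⟩ := Submodule.mkQ_surjective _ (s.1 N)
  obtain ⟨x, rfl⟩ := Submodule.mkQ_surjective _ x
  have h₁ : ZGradedLieAlgebra.level N s = ZGradedLieAlgebra.level N (incl p x) := hx.symm
  rw [derivation_isContinuous f hq N _ _ (derivation_isContinuous f hp N _ _ h₁),
    derivation_incl, key]

end FreeZGradedLie

/-! ### The Lawrence-Sullivan interval -/

/-- The generators of the Lawrence-Sullivan interval. -/
inductive LSGen : Type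
  | a | b | x

namespace LSInterval

open ZGradedLieAlgebra FreeZGradedLie

/-- The degrees of the generators: `a` and `b` of degree `-1`, `x` of degree `0`. -/
def deg : LSGen → ℤ
  | .a => -1
  | .b => -1
  | .x => 0

/-- The generator `a`. -/
def a : (Complete deg).obj (-1) := gen .a rfl

/-- The generator `b`. -/
def b : (Complete deg).obj (-1) := gen .b rfl

/-- The generator `x`. -/
def x : (Complete deg).obj 0 := gen .x rfl

/-- The differential on the generators: `∂ a = -½ [a, a]`, `∂ b = -½ [b, b]` and
`∂ x = [x, b] + ∑ₙ (Bₙ / n!) adₓⁿ (b - a)`. -/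
def dGen : GenValues deg
  | .a, _, h => (-(1 / 2) : ℚ) • (Complete deg).bracket (by rw [deg] at h; omega) a a
  | .b, _, h => (-(1 / 2) : ℚ) • (Complete deg).bracket (by rw [deg] at h; omega) b b
  | .x, q, h =>
    have hq : q = -1 := by rw [deg] at h; omega
    hq ▸ ((Complete deg).bracket (zero_add (-1)) x b + adSeries bernoulliCoeff x (b - a))

theorem d_a : (derivation dGen).map (p := -1) (q := -2) (by norm_num) a
    = (-(1 / 2) : ℚ) • (Complete deg).bracket (p := -1) (q := -1) (by norm_num) a a :=
  derivation_gen dGen .a _ rfl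

theorem d_b : (derivation dGen).map (p := -1) (q := -2) (by norm_num) b
    = (-(1 / 2) : ℚ) • (Complete deg).bracket (p := -1) (q := -1) (by norm_num) b b :=
  derivation_gen dGen .b _ rfl

theorem d_x : (derivation dGen).map (p := 0) (q := -1) (by norm_num) x
    = (Complete deg).bracket (zero_add (-1)) x b + adSeries bernoulliCoeff x (b - a) :=
  derivation_gen dGen .x _ rfl

end LSInterval

open ZGradedLieAlgebra FreeZGradedLie LSInterval in
/-- The Lawrence-Sullivan interval: the completed free graded Lie algebra on `a`, `b` of degree `-1`
and `x` of degree `0`, with the differential `∂` for which `a` and `b` are Maurer-Cartan elements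
and `∂ x = adₓ b + ∑ₙ (Bₙ / n!) adₓⁿ (b - a)`. -/
@[reducible] def LSInterval : DGLieAlgebra where
  toZGradedLieAlgebra := Complete LSInterval.deg
  d := derivation dGen
  d_sq := derivation_sq dGen <| by
    have hc := derivation_isContinuous dGen
    intro g q r hr hq
    cases g with
    | a =>
      obtain rfl : q = -2 := by rw [LSInterval.deg] at hq; omega
      obtain rfl : r = -3 := by omega
      exact (congrArg _ d_a).symm.trans (derivation_sq_odd _ _ _ d_a)
    | b =>
      obtain rfl : q = -2 := by rw [LSInterval.deg] at hq; omega
      obtain rfl : r = -3 := by omega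
      exact (congrArg _ d_b).symm.trans (derivation_sq_odd _ _ _ d_b)
    | x =>
      obtain rfl : q = -1 := by rw [LSInterval.deg] at hq; omega
      obtain rfl : r = -2 := by omega
      exact (congrArg _ d_x).symm.trans (derivation_sq_x _ hc _ _ _ d_a d_b d_x)

/-- The linear part of a degree `p` element of the Lawrence-Sullivan interval: its component of
word length one, in the vector space with basis `a`, `b`, `x`. -/
def LSInterval.linearPart (p : ℤ) : LSInterval.obj p →ₗ[ℚ] (LSGen →₀ ℚ) :=
  FreeZGradedLie.linearPart (deg := LSInterval.deg) p

theorem LSInterval.linearPart_a : LSInterval.linearPart (-1) LSInterval.a = Finsupp.single .a 1 := by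
  change FreeZGradedLie.magmaLinear LSInterval.deg (-1) (FreeZGradedLie.word (.of .a) rfl) = _
  simp [FreeZGradedLie.magmaLinear, FreeZGradedLie.word]

theorem LSInterval.a_mem_MC : LSInterval.a ∈ LSInterval.MC := by
  change (FreeZGradedLie.derivation LSInterval.dGen).map _ LSInterval.a + _ = 0
  rw [LSInterval.d_a]
  module

theorem LSInterval.b_mem_MC : LSInterval.b ∈ LSInterval.MC := by
  change (FreeZGradedLie.derivation LSInterval.dGen).map _ LSInterval.b + _ = 0
  rw [LSInterval.d_b]
  module

end

noncomputable section

open ZGradedLieAlgebra FreeZGradedLie Polynomial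

namespace LSInterval

/-! Since `a`, `b` have degree `-1` and `x` has degree `0`, a degree `-1` word contains exactly one
of `a`, `b` and otherwise only `x`. So in degree `-1` the word length `n + 1` part of the free
algebra is spanned by `adₓⁿ a` and `adₓⁿ b` (`lcs_deg_neg_one`, and `exists_level_succ_eq` in the
completion).

Let `∂₁` be the part of `∂` that preserves word length; it kills `a` and `b` and sends `x` to `b -
a`. In word length `k` the Maurer-Cartan equation expresses `∂₁ ω_k` through components of `ω` of
length less than `k`: the higher parts of `∂` raise word length, and `[ω, ω]` in length `k` pairs
components whose lengths are at least `1` and add up to `k`. Hence `ω` is determined by its linear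
part as soon as `∂₁` is injective on degree `-1` elements of length at least `2`.

Injectivity is detected by mapping the free algebra to a small model: `x` acts on `ℚ[X]` as
multiplication by `X`, `a` and `b` become constants `γ`, `δ`, and `[f, g] = f(0) g + g(0) f` for odd
`f`, `g`. There `∂₁ (adₓⁿ z)` is the sum of the `adₓⁱ [b - a, adₓⁿ⁻¹⁻ⁱ z]` for `i < n`. If `z` maps
to the constant `ζ`, each term is `(δ - γ) ζ Xⁿ⁻¹`, except that the last is twice this, both its
factors being constants. The total `(n + 1)(δ - γ) ζ Xⁿ⁻¹` is `coeffTwo_d_ad_pow`. For `z = α a + β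
b`, where `ζ = α γ + β δ`, the two choices `(γ, δ) = (1, 0)` and `(0, 1)` recover `α` and `β`.

The final induction, `level_sub_eq_zero`, is on the word length up to which two Maurer-Cartan
elements agree. Everything is phrased with coefficient functionals that factor through the quotients
by the lower central series, so no word length grading or splitting of `∂` is needed. Note that
`level n` is the class modulo `Lⁿ⁺¹`: it retains word lengths up to `n`. -/

/-! ### A quotient of the free graded Lie algebra -/

/-- The underlying space of a quotient of the free graded Lie algebra on `a`, `b`, `x`: one copy of
`ℚ` in degree `0`, spanned by `x`, and one copy of `ℚ[X]` in each of the degrees `-1` and `-2`. -/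
abbrev Model : Type := ℚ × ℚ[X] × ℚ[X]

/-- The bracket of the model: `x` acts as multiplication by `X`, and
`[f, g] = f(0) g + g(0) f` for `f`, `g` of degree `-1`. -/
def modelMul : Model →ₗ[ℚ] Model →ₗ[ℚ] Model :=
  LinearMap.mk₂ ℚ (fun u v => (0, u.1 • (X * v.2.1) - v.1 • (X * u.2.1),
      u.1 • (X * v.2.2) - v.1 • (X * u.2.2) + (u.2.1.coeff 0 • v.2.1 + v.2.1.coeff 0 • u.2.1)))
    (fun u u' v => by
      ext1
      · simp
      · ext1 <;> simp [add_smul, mul_add] <;> abel)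
    (fun c u v => by
      ext1
      · simp
      · ext1 <;> simp only [Prod.smul_fst, Prod.smul_snd, mul_smul_comm, Polynomial.coeff_smul,
          smul_eq_mul] <;> module)
    (fun u v v' => by
      ext1
      · simp
      · ext1 <;> simp [add_smul, mul_add] <;> abel)
    (fun c u v => by
      ext1
      · simp
      · ext1 <;> simp only [Prod.smul_fst, Prod.smul_snd, mul_smul_comm, Polynomial.coeff_smul,
          smul_eq_mul] <;> module)

theorem modelMul_apply (u v : Model) : modelMul u v = (0, u.1 • (X * v.2.1) - v.1 • (X * u.2.1),
      u.1 • (X * v.2.2) - v.1 • (X * u.2.2) + (u.2.1.coeff 0 • v.2.1 + v.2.1.coeff 0 • u.2.1)) :=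
  rfl

/-- The homogeneous elements of degree `p` of the model. -/
inductive Model.IsHom : ℤ → Model → Prop
  | zero (p : ℤ) : IsHom p 0
  | deg_zero (c : ℚ) : IsHom 0 (c, 0, 0)
  | deg_one (f : ℚ[X]) : IsHom (-1) (0, f, 0)
  | deg_two (f : ℚ[X]) : IsHom (-2) (0, 0, f)

theorem Model.IsHom.mul {p q : ℤ} {u v : Model} (hu : IsHom p u) (hv : IsHom q v) :
    IsHom (p + q) (modelMul u v) := by
  cases hu with
  | zero => simpa using IsHom.zero _
  | deg_zero c =>
    cases hv with
    | zero => simpa using IsHom.zero _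
    | deg_zero c' =>
      convert IsHom.zero _ using 1
      simp [modelMul_apply]
    | deg_one f => simpa [modelMul_apply] using IsHom.deg_one _
    | deg_two f => simpa [modelMul_apply] using IsHom.deg_two _
  | deg_one f =>
    cases hv with
    | zero => simpa using IsHom.zero _
    | deg_zero c' => simpa [modelMul_apply] using IsHom.deg_one _
    | deg_one f => simpa [modelMul_apply] using IsHom.deg_two _
    | deg_two f =>
      convert IsHom.zero _ using 1
      simp [modelMul_apply]
  | deg_two f =>
    cases hv with
    | zero => simpa using IsHom.zero _
    | deg_zero c' => simpa [modelMul_apply] using IsHom.deg_two _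
    | deg_one f =>
      convert IsHom.zero _ using 1
      simp [modelMul_apply]
    | deg_two f =>
      convert IsHom.zero _ using 1
      simp [modelMul_apply]

theorem modelMul_antisymm {p q : ℤ} {u v : Model} (hu : Model.IsHom p u) (hv : Model.IsHom q v) :
    modelMul u v + (-1 : ℚ) ^ (p * q) • modelMul v u = 0 := by
  cases hu <;> cases hv <;> simp [modelMul_apply]
  module

/-- The only case with content is that of `x` and two odd elements `f`, `g`: multiplication by `X`
is a derivation of `f(0) g + g(0) f` because `(X f)(0) = 0`. Three odd elements bracket into degree
`-3`, where the model vanishes. -/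
theorem modelMul_jacobi {p q r : ℤ} {u v w : Model} (hu : Model.IsHom p u)
    (hv : Model.IsHom q v) (hw : Model.IsHom r w) :
    (-1 : ℚ) ^ (p * r) • modelMul u (modelMul v w)
      + (-1 : ℚ) ^ (q * p) • modelMul v (modelMul w u)
      + (-1 : ℚ) ^ (r * q) • modelMul w (modelMul u v) = 0 := by
  cases hu <;> cases hv <;> cases hw <;>
    simp [modelMul_apply, smul_smul, mul_add] <;> module

/-! ### The map from the free graded Lie algebra to the model -/

/-- The image of a word in the model, for `a` and `b` mapped to the constants `α` and `β`. -/
def modelWord (α β : ℚ) : FreeMagma LSGen → Model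
  | .of .a => (0, C α, 0)
  | .of .b => (0, C β, 0)
  | .of .x => (1, 0, 0)
  | .mul u v => modelMul (modelWord α β u) (modelWord α β v)

variable (α β : ℚ)

theorem modelWord_isHom (w : FreeMagma LSGen) :
    Model.IsHom (wordDeg deg w) (modelWord α β w) := by
  induction w using FreeMagma.rec with
  | of g =>
    cases g
    · exact .deg_one _
    · exact .deg_one _
    · exact .deg_zero _
  | mul u v hu hv => exact hu.mul hv

/-- The map from the free nonassociative algebra to the model. -/
def modelMagma (p : ℤ) : Magma deg p →ₗ[ℚ] Model :=
  Finsupp.linearCombination ℚ fun w => modelWord α β w.1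

theorem modelMagma_word {p : ℤ} (w : FreeMagma LSGen) (h : wordDeg deg w = p) :
    modelMagma α β p (word w h) = modelWord α β w := by
  simp [modelMagma, word]

theorem modelMagma_mul {p q r : ℤ} (h : p + q = r) (u : Magma deg p) (v : Magma deg q) :
    modelMagma α β r (magmaMul h u v) = modelMul (modelMagma α β p u) (modelMagma α β q v) := by
  induction u using magma_induction with
  | zero => simp
  | add x y hx hy => simp [hx, hy]
  | smul c x hx => simp [hx]
  | word u hu =>
  induction v using magma_induction with
  | zero => simp
  | add x y hx hy => simp [hx, hy]
  | smul c x hx => simp [hx]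
  | word v hv =>
    rw [magmaMul_word, modelMagma_word, modelMagma_word, modelMagma_word, modelWord]

/-- The signs in the relations depend on degrees, so the identities of the model hold only for
homogeneous elements; `modelWord_isHom` supplies homogeneity for the words in the relators. -/
theorem ideal_le_ker_modelMagma (p : ℤ) :
    ideal deg p ≤ LinearMap.ker (modelMagma α β p) := by
  refine Submodule.span_le.2 ?_
  intro x hx
  change modelMagma α β p x = 0
  induction hx with
  | antisymm u v hu hv h h' =>
    subst hu hv
    simpa [modelMagma_mul, modelMagma_word] using
      modelMul_antisymm (modelWord_isHom α β u) (modelWord_isHom α β v)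
  | jacobi u v w hu hv hw hqr hrp hpq h₁ h₂ h₃ =>
    subst hu hv hw
    simpa only [map_add, map_smul, modelMagma_mul, modelMagma_word] using
      modelMul_jacobi (modelWord_isHom α β u) (modelWord_isHom α β v) (modelWord_isHom α β w)
  | mul_left h u hu x _ ih => simp [modelMagma_mul, ih]
  | mul_right h x v hv _ ih => simp [modelMagma_mul, ih]

/-- The map from the free graded Lie algebra to the model. -/
def toModel (p : ℤ) : (FreeZGradedLie deg).obj p →ₗ[ℚ] Model :=
  (ideal deg p).liftQ (modelMagma α β p) (ideal_le_ker_modelMagma α β p)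

theorem toModel_bracket {p q r : ℤ} (h : p + q = r) (u : (FreeZGradedLie deg).obj p)
    (v : (FreeZGradedLie deg).obj q) :
    toModel α β r ((FreeZGradedLie deg).bracket h u v)
      = modelMul (toModel α β p u) (toModel α β q v) := by
  obtain ⟨u, rfl⟩ := Submodule.mkQ_surjective _ u
  obtain ⟨v, rfl⟩ := Submodule.mkQ_surjective _ v
  exact modelMagma_mul α β h u v

/-- Removes the `x`-action terms from the bracket of two degree `-1` elements. -/
theorem toModel_fst {p : ℤ} (hp : p ≠ 0) (u : (FreeZGradedLie deg).obj p) :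
    (toModel α β p u).1 = 0 := by
  obtain ⟨u, rfl⟩ := Submodule.mkQ_surjective _ u
  change (modelMagma α β p u).1 = 0
  induction u using magma_induction with
  | zero => simp
  | add x y hx hy => simp [hx, hy]
  | smul c x hx => simp [hx]
  | word u hu =>
    rw [modelMagma_word]
    have := modelWord_isHom α β u
    generalize modelWord α β u = v at *
    rw [hu] at this
    cases this <;> simp_all

/-- Bracketing with `x` gains a factor `X`, while the bracket of two odd elements gains none at its
first use: `[a, a]` has length two and maps to a constant. Hence the exponent in degree `-2` lags by
one, and the factor `X` in the last clause expresses this without natural subtraction. The three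
clauses feed each other in the induction. -/
theorem toModel_lcs (n : ℕ) {p : ℤ} {u : (FreeZGradedLie deg).obj p}
    (hu : u ∈ (FreeZGradedLie deg).lcs n p) : (n ≠ 0 → (toModel α β p u).1 = 0) ∧
      X ^ n ∣ (toModel α β p u).2.1 ∧ X ^ n ∣ X * (toModel α β p u).2.2 := by
  induction n generalizing p with
  | zero => simp
  | succ n ih =>
    refine Submodule.span_induction (p := fun u _ => (n + 1 ≠ 0 → (toModel α β p u).1 = 0) ∧
      X ^ (n + 1) ∣ (toModel α β p u).2.1 ∧ X ^ (n + 1) ∣ X * (toModel α β p u).2.2)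
      ?_ (by simp) ?_ ?_ hu
    · rintro _ ⟨p', q, h, u, v, hv, rfl⟩
      obtain ⟨h₁, h₂, h₃⟩ := ih hv
      rw [toModel_bracket, modelMul_apply]
      generalize toModel α β p' u = u at *
      generalize toModel α β q v = v at *
      have hX : ∀ f : ℚ[X], X ^ n ∣ f → X ^ (n + 1) ∣ X * f := fun f hf => by
        rw [pow_succ']; exact mul_dvd_mul_left X hf
      -- In the terms where `v` only contributes a scalar, the polynomial comes from the arbitrary
      -- factor `u` and provides a single `X`. This suffices for `n = 0`; for `n > 0` the scalar is
      -- zero, by the first clause for `v.1` and by divisibility for the constant coefficient of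
      -- `v.2.1`.
      have hv₁ : ∀ f : ℚ[X], X ^ (n + 1) ∣ v.1 • (X * f) := fun f => by
        by_cases hn : n = 0
        · subst hn; simpa using dvd_smul_of_dvd v.1 (dvd_mul_right X f)
        · simp [h₁ hn]
      have hv₂ : ∀ f : ℚ[X], X ^ (n + 1) ∣ v.2.1.coeff 0 • (X * f) := fun f => by
        by_cases hn : n = 0
        · subst hn; simpa using dvd_smul_of_dvd (v.2.1.coeff 0) (dvd_mul_right X f)
        · simp [X_pow_dvd_iff.1 h₂ 0 (by omega)]
      refine ⟨fun _ => rfl, dvd_sub (dvd_smul_of_dvd _ (hX _ h₂)) (hv₁ _), ?_⟩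
      simp only [mul_add, mul_sub, mul_smul_comm]
      exact dvd_add (dvd_sub (dvd_smul_of_dvd _ (hX _ h₃)) (hv₁ _))
        (dvd_add (dvd_smul_of_dvd _ (hX _ h₂)) (hv₂ _))
    · rintro u v - - ⟨h₁, h₂, h₃⟩ ⟨h₁', h₂', h₃'⟩
      simp only [map_add, Prod.fst_add, Prod.snd_add, mul_add]
      exact ⟨fun h => by rw [h₁ h, h₁' h, add_zero], dvd_add h₂ h₂', dvd_add h₃ h₃'⟩
    · rintro c u - ⟨h₁, h₂, h₃⟩
      simp only [map_smul, Prod.smul_fst, Prod.smul_snd, mul_smul_comm]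
      exact ⟨fun h => by rw [h₁ h, smul_zero], dvd_smul_of_dvd c h₂, dvd_smul_of_dvd c h₃⟩

/-! ### Functionals on the completion -/

/-- The coefficient of `X ^ m` of the image in the degree `-1` part of the model. -/
def coeffOne (m : ℕ) : (Complete deg).obj (-1) →ₗ[ℚ] ℚ :=
  ((FreeZGradedLie deg).lcs (m + 1) (-1)).liftQ
    (lcoeff ℚ m ∘ₗ LinearMap.fst ℚ _ _ ∘ₗ LinearMap.snd ℚ _ _ ∘ₗ toModel α β (-1))
    (fun _ hu => X_pow_dvd_iff.1 (toModel_lcs α β _ hu).2.1 m m.lt_succ_self) ∘ₗ level (m + 1)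

/-- The coefficient of `X ^ m` of the image in the degree `-2` part of the model. -/
def coeffTwo (m : ℕ) : (Complete deg).obj (-2) →ₗ[ℚ] ℚ :=
  ((FreeZGradedLie deg).lcs (m + 2) (-2)).liftQ
    (lcoeff ℚ m ∘ₗ LinearMap.snd ℚ _ _ ∘ₗ LinearMap.snd ℚ _ _ ∘ₗ toModel α β (-2))
    (fun _ hu => by
      -- `X ^ (m + 2)` divides `X * f`, so the coefficient of `X ^ (m + 1)` in `X * f`, which is
      -- that of `X ^ m` in `f`, vanishes.
      have := X_pow_dvd_iff.1 (toModel_lcs α β _ hu).2.2 (m + 1) (by omega)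
      rwa [coeff_X_mul] at this) ∘ₗ level (m + 2)

theorem level_of_le {p : ℤ} {s t : (Complete deg).obj p} {m n : ℕ} (h : m ≤ n)
    (hst : level n s = level n t) : level m s = level m t := by
  change s.1 m = t.1 m
  rw [← s.2 m n h, ← t.2 m n h]
  exact congrArg _ hst

/-- Reduces identities between coefficient functionals to the free algebra before completion, where
`toModel_bracket` applies. -/
theorem exists_level_eq (n : ℕ) {p : ℤ} (s : (Complete deg).obj p) :
    ∃ u : (FreeZGradedLie deg).obj p,
      level n s = level n ((FreeZGradedLie deg).toCompletion p u) := by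
  obtain ⟨u, hu⟩ := Submodule.mkQ_surjective _ (level n s)
  exact ⟨u, hu.symm⟩

-- The coefficient of `X ^ m` in degree `-1` is word length `m + 1` information, hence visible
-- modulo `Lᵐ⁺²`. In degree `-2` it belongs to word length `m + 2`.
variable {α β} in
theorem coeffOne_congr {m n : ℕ} (h : m < n) {s t : (Complete deg).obj (-1)}
    (hst : level n s = level n t) : coeffOne α β m s = coeffOne α β m t := by
  rw [coeffOne, LinearMap.comp_apply, LinearMap.comp_apply, level_of_le h hst]

variable {α β} in
theorem coeffTwo_congr {m n : ℕ} (h : m + 2 ≤ n) {s t : (Complete deg).obj (-2)}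
    (hst : level n s = level n t) : coeffTwo α β m s = coeffTwo α β m t := by
  rw [coeffTwo, LinearMap.comp_apply, LinearMap.comp_apply, level_of_le h hst]

theorem coeffOne_toCompletion (m : ℕ) (u : (FreeZGradedLie deg).obj (-1)) :
    coeffOne α β m ((FreeZGradedLie deg).toCompletion (-1) u)
      = (toModel α β (-1) u).2.1.coeff m := rfl

theorem coeffTwo_toCompletion (m : ℕ) (u : (FreeZGradedLie deg).obj (-2)) :
    coeffTwo α β m ((FreeZGradedLie deg).toCompletion (-2) u)
      = (toModel α β (-2) u).2.2.coeff m := rfl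

/-! ### Coefficients of generators and of brackets -/

/-- The generator `a` of the free graded Lie algebra. -/
def freeA : (FreeZGradedLie deg).obj (-1) := (ideal deg (-1)).mkQ (word (.of .a) rfl)

/-- The generator `b` of the free graded Lie algebra. -/
def freeB : (FreeZGradedLie deg).obj (-1) := (ideal deg (-1)).mkQ (word (.of .b) rfl)

/-- The generator `x` of the free graded Lie algebra. -/
def freeX : (FreeZGradedLie deg).obj 0 := (ideal deg 0).mkQ (word (.of .x) rfl)

theorem toModel_freeA : toModel α β (-1) freeA = (0, C α, 0) := modelMagma_word α β (.of .a) rfl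

theorem toModel_freeB : toModel α β (-1) freeB = (0, C β, 0) := modelMagma_word α β (.of .b) rfl

theorem toModel_freeX : toModel α β 0 freeX = (1, 0, 0) := modelMagma_word α β (.of .x) rfl

theorem coeffOne_a (m : ℕ) : coeffOne α β m a = if m = 0 then α else 0 := by
  refine (coeffOne_toCompletion α β m freeA).trans ?_
  rw [toModel_freeA]
  exact coeff_C

theorem coeffOne_b (m : ℕ) : coeffOne α β m b = if m = 0 then β else 0 := by
  refine (coeffOne_toCompletion α β m freeB).trans ?_
  rw [toModel_freeB]
  exact coeff_C

theorem toModel_bracket_x {p : ℤ} (u : (FreeZGradedLie deg).obj p) :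
    toModel α β p ((FreeZGradedLie deg).bracket (zero_add p) freeX u)
      = (0, X * (toModel α β p u).2.1, X * (toModel α β p u).2.2) := by
  rw [toModel_bracket, toModel_freeX]
  simp [modelMul_apply]

theorem coeffOne_bracket_x_zero (s : (Complete deg).obj (-1)) :
    coeffOne α β 0 ((Complete deg).bracket (zero_add (-1)) x s) = 0 := by
  obtain ⟨u, hu⟩ := exists_level_eq 1 s
  rw [coeffOne_congr zero_lt_one (level_bracket_congr 1 (zero_add (-1)) (s := x) rfl hu)]
  refine (coeffOne_toCompletion α β 0
    ((FreeZGradedLie deg).bracket (zero_add (-1)) freeX u)).trans ?_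
  rw [toModel_bracket_x]
  simp

theorem coeffTwo_bracket_x_zero (s : (Complete deg).obj (-2)) :
    coeffTwo α β 0 ((Complete deg).bracket (zero_add (-2)) x s) = 0 := by
  obtain ⟨u, hu⟩ := exists_level_eq 2 s
  rw [coeffTwo_congr (zero_add 2).le (level_bracket_congr 2 (zero_add (-2)) (s := x) rfl hu)]
  refine (coeffTwo_toCompletion α β 0
    ((FreeZGradedLie deg).bracket (zero_add (-2)) freeX u)).trans ?_
  rw [toModel_bracket_x]
  simp

theorem coeffTwo_bracket_x_succ (m : ℕ) (s : (Complete deg).obj (-2)) :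
    coeffTwo α β (m + 1) ((Complete deg).bracket (zero_add (-2)) x s) = coeffTwo α β m s := by
  obtain ⟨u, hu⟩ := exists_level_eq (m + 3) s
  rw [coeffTwo_congr le_rfl (level_bracket_congr (m + 3) (zero_add (-2)) (s := x) rfl hu),
    coeffTwo_congr (by omega) hu]
  refine (coeffTwo_toCompletion α β (m + 1)
    ((FreeZGradedLie deg).bracket (zero_add (-2)) freeX u)).trans ?_
  rw [toModel_bracket_x, coeffTwo_toCompletion]
  simp

theorem coeffOne_bracket_x_succ (m : ℕ) (s : (Complete deg).obj (-1)) :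
    coeffOne α β (m + 1) ((Complete deg).bracket (zero_add (-1)) x s) = coeffOne α β m s := by
  obtain ⟨u, hu⟩ := exists_level_eq (m + 2) s
  rw [coeffOne_congr (by omega) (level_bracket_congr (m + 2) (zero_add (-1)) (s := x) rfl hu),
    coeffOne_congr (by omega) hu]
  refine (coeffOne_toCompletion α β (m + 1)
    ((FreeZGradedLie deg).bracket (zero_add (-1)) freeX u)).trans ?_
  rw [toModel_bracket_x, coeffOne_toCompletion]
  simp

/-- This form of the model bracket is what closes the main induction: the right side involves `s`
and `t` only through word lengths `1` and `m + 1`, although the bracket is read in length `m + 2`.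
-/
theorem coeffTwo_bracket (m : ℕ) (h : (-1 : ℤ) + -1 = -2) (s t : (Complete deg).obj (-1)) :
    coeffTwo α β m ((Complete deg).bracket h s t)
      = coeffOne α β 0 s * coeffOne α β m t + coeffOne α β 0 t * coeffOne α β m s := by
  obtain ⟨u, hu⟩ := exists_level_eq (m + 2) s
  obtain ⟨v, hv⟩ := exists_level_eq (m + 2) t
  rw [coeffTwo_congr le_rfl (level_bracket_congr (m + 2) h hu hv),
    coeffOne_congr (by omega) hu, coeffOne_congr (by omega) hv,
    coeffOne_congr (by omega) hu, coeffOne_congr (by omega) hv]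
  refine (coeffTwo_toCompletion α β m ((FreeZGradedLie deg).bracket h u v)).trans ?_
  rw [toModel_bracket, modelMul_apply, coeffOne_toCompletion, coeffOne_toCompletion,
    coeffOne_toCompletion, coeffOne_toCompletion, toModel_fst α β (by norm_num) u,
    toModel_fst α β (by norm_num) v]
  simp

/-! ### The differential of `adₓⁿ z` -/

/-- Modulo `L²` only the term `n = 0` of the Bernoulli series survives, and `B₀ = 1`, so `∂ x` is `b
- a` there. No other Bernoulli number enters the argument for uniqueness. -/
theorem coeffOne_d_x : coeffOne α β 0
    ((derivation dGen).map (p := 0) (q := -1) (by norm_num) x) = β - α := by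
  rw [d_x, map_add, coeffOne_bracket_x_zero,
    coeffOne_congr zero_lt_one (level_adSeries _ _ _ le_rfl)]
  simp only [bernoulliCoeff, Finset.sum_range_one, pow_zero, Module.End.one_apply]
  rw [map_smul, map_sub, coeffOne_a, coeffOne_b]
  simp

/-- Induction through `∂ [x, w] = [∂ x, w] + [x, ∂ w]`. The second term shifts the previous
coefficient; the first adds `(β - α) z(0)`, or twice that at the start. The unknown `∂ z`
contributes nothing, since `m + 1` multiplications by `X` push it beyond `X ^ m`. -/
theorem coeffTwo_d_ad_pow (m : ℕ) (z : (Complete deg).obj (-1)) :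
    coeffTwo α β m ((derivation dGen).map (p := -1) (q := -2) (by norm_num)
      (((Complete deg).bracket (zero_add (-1)) x ^ (m + 1)) z))
      = (m + 2) * ((β - α) * coeffOne α β 0 z) := by
  induction m with
  | zero =>
    -- Both products in `coeffTwo_bracket` coincide for `m = 0`, which gives the initial factor `2`.
    rw [zero_add, pow_one, derivation_ad, map_add, coeffTwo_bracket, coeffTwo_bracket_x_zero,
      coeffOne_d_x]
    push_cast
    ring
  | succ m ih =>
    have hz : ∀ k z, coeffOne α β k (((Complete deg).bracket (zero_add (-1)) x ^ k) z)
        = coeffOne α β 0 z := by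
      intro k z
      induction k with
      | zero => rfl
      | succ k ih => rw [pow_succ', Module.End.mul_apply, coeffOne_bracket_x_succ, ih]
    -- The higher coefficient of `∂ x` is multiplied by the constant coefficient of `adₓᵐ⁺¹ z`,
    -- which is zero; only the constant coefficient of `∂ x` remains.
    rw [pow_succ', Module.End.mul_apply, derivation_ad, map_add, coeffTwo_bracket,
      coeffTwo_bracket_x_succ, ih, hz, coeffOne_d_x, pow_succ', Module.End.mul_apply,
      coeffOne_bracket_x_zero]
    push_cast
    ring

/-! ### Degrees `0` and `-1` of the free graded Lie algebra -/

theorem wordDeg_nonpos (w : FreeMagma LSGen) : wordDeg deg w ≤ 0 := by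
  induction w using FreeMagma.rec with
  | of g => cases g <;> simp [wordDeg, deg]
  | mul u v hu hv => rw [wordDeg]; omega

theorem free_eq_zero {p : ℤ} (hp : 0 < p) (u : (FreeZGradedLie deg).obj p) : u = 0 := by
  obtain ⟨u, rfl⟩ := Submodule.mkQ_surjective _ u
  induction u using magma_induction with
  | zero => simp
  | add x y hx hy => rw [map_add, hx, hy, add_zero]
  | smul c x hx => rw [map_smul, hx, smul_zero]
  | word w hw => have := wordDeg_nonpos w; omega

theorem free_bracket_x_x :
    (FreeZGradedLie deg).bracket (zero_add 0) freeX freeX = 0 := by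
  have := (FreeZGradedLie deg).antisymm (zero_add 0) (zero_add 0) freeX freeX
  rw [mul_zero, zpow_zero, one_smul] at this
  linear_combination (norm := module) (1 / 2 : ℚ) • this

/-- No generator has positive degree, so a word of degree `0` has both factors of degree `0`. By
induction these are multiples of `x`, and `[x, x] = 0`. -/
theorem free_deg_zero (u : (FreeZGradedLie deg).obj 0) : ∃ c : ℚ, u = c • freeX := by
  obtain ⟨u, rfl⟩ := Submodule.mkQ_surjective _ u
  induction u using magma_induction with
  | zero => exact ⟨0, by rw [map_zero, zero_smul]⟩
  | add x y hx hy =>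
    obtain ⟨c, hc⟩ := hx
    obtain ⟨d, hd⟩ := hy
    exact ⟨c + d, by rw [map_add, hc, hd]; module⟩
  | smul c x hx =>
    obtain ⟨d, hd⟩ := hx
    exact ⟨c * d, by rw [map_smul, hd]; module⟩
  | word w hw =>
    induction w using FreeMagma.rec with
    | of g =>
      cases g with
      | a => simp [wordDeg, deg] at hw
      | b => simp [wordDeg, deg] at hw
      | x => exact ⟨1, (one_smul _ _).symm⟩
    | mul u v ihu ihv =>
      have hu := wordDeg_nonpos u
      have hv := wordDeg_nonpos v
      rw [wordDeg] at hw
      have hu : wordDeg deg u = 0 := by omega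
      have hv : wordDeg deg v = 0 := by omega
      obtain ⟨c, hc⟩ := ihu hu
      obtain ⟨d, hd⟩ := ihv hv
      refine ⟨0, ?_⟩
      have e : (ideal deg 0).mkQ (word (.mul u v) hw) = (FreeZGradedLie deg).bracket (zero_add 0)
          ((ideal deg 0).mkQ (word u hu)) ((ideal deg 0).mkQ (word v hv)) :=
        congrArg (ideal deg 0).mkQ (magmaMul_word (zero_add 0) hu hv).symm
      rw [e, hc, hd, map_smul, map_smul, LinearMap.smul_apply, free_bracket_x_x]
      simp

theorem lcs_succ_deg_zero (n : ℕ) {u : (FreeZGradedLie deg).obj 0}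
    (hu : u ∈ (FreeZGradedLie deg).lcs (n + 1) 0) : u = 0 := by
  refine (Submodule.mem_bot ℚ).1 (Submodule.span_le.2 ?_ hu)
  rintro _ ⟨p, q, h, u, v, -, rfl⟩
  rw [SetLike.mem_coe, Submodule.mem_bot]
  rcases lt_or_ge 0 p with hp | hp
  · rw [free_eq_zero hp u]; simp
  rcases lt_or_ge 0 q with hq | hq
  · rw [free_eq_zero hq v]; simp
  obtain rfl : p = 0 := by omega
  obtain rfl : q = 0 := by omega
  obtain ⟨c, rfl⟩ := free_deg_zero u
  obtain ⟨d, rfl⟩ := free_deg_zero v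
  rw [map_smul, map_smul, LinearMap.smul_apply, free_bracket_x_x]
  simp

/-! ### Successive quotients of the lower central series in degree `-1` -/

/-- `adₓⁿ(α a + β b)` in the free graded Lie algebra. -/
def freeAdPow (n : ℕ) (α β : ℚ) : (FreeZGradedLie deg).obj (-1) :=
  ((FreeZGradedLie deg).bracket (zero_add (-1)) freeX ^ n)
    (α • freeA + β • freeB)

/-- Nonpositivity of degrees forces one factor of a degree `-1` bracket to have degree `0`, hence to
be a multiple of `x`. Each step down the series is therefore one more application of `adₓ`. -/
theorem lcs_deg_neg_one (n : ℕ) {u : (FreeZGradedLie deg).obj (-1)}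
    (hu : u ∈ (FreeZGradedLie deg).lcs n (-1)) :
    ∃ α β : ℚ, u - freeAdPow n α β ∈ (FreeZGradedLie deg).lcs (n + 1) (-1) := by
  have hadd : ∀ n α β α' β', freeAdPow n (α + α') (β + β')
      = freeAdPow n α β + freeAdPow n α' β' := fun n α β α' β' => by
    rw [freeAdPow, freeAdPow, freeAdPow, ← map_add]; congr 1; module
  have hsmul : ∀ n c α β, freeAdPow n (c * α) (c * β) = c • freeAdPow n α β :=
    fun n c α β => by
      rw [freeAdPow, freeAdPow, ← map_smul]; congr 1; module
  have hzero : ∀ n, freeAdPow n 0 0 = 0 := fun n => by simp [freeAdPow]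
  induction n generalizing u with
  | zero =>
    clear hu
    obtain ⟨u, rfl⟩ := Submodule.mkQ_surjective _ u
    induction u using magma_induction with
    | zero => exact ⟨0, 0, by simp [hzero]⟩
    | add x y hx hy =>
      obtain ⟨α, β, h⟩ := hx
      obtain ⟨α', β', h'⟩ := hy
      refine ⟨α + α', β + β', ?_⟩
      rw [map_add, hadd, add_sub_add_comm]
      exact add_mem h h'
    | smul c x hx =>
      obtain ⟨α, β, h⟩ := hx
      refine ⟨c * α, c * β, ?_⟩
      rw [map_smul, hsmul, ← smul_sub]
      exact Submodule.smul_mem _ c h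
    | word w hw =>
      cases w with
      | of g =>
        cases g with
        | a =>
          refine ⟨1, 0, ?_⟩
          rw [freeAdPow, pow_zero, Module.End.one_apply, one_smul, zero_smul, add_zero]
          rw [show (ideal deg (-1)).mkQ (word (.of .a) hw) - freeA = 0 from sub_self freeA]
          exact zero_mem _
        | b =>
          refine ⟨0, 1, ?_⟩
          rw [freeAdPow, pow_zero, Module.End.one_apply, one_smul, zero_smul,
            zero_add freeB]
          rw [show (ideal deg (-1)).mkQ (word (.of .b) hw) - freeB = 0 from sub_self freeB]
          exact zero_mem _
        | x => simp [wordDeg, deg] at hw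
      | mul u v =>
        -- A word of length at least two is a bracket, so it already vanishes modulo `L²`.
        refine ⟨0, 0, ?_⟩
        rw [hzero, sub_zero]
        have e : (ideal deg (-1)).mkQ (word (.mul u v) hw) = (FreeZGradedLie deg).bracket hw
            ((ideal deg _).mkQ (word u rfl)) ((ideal deg _).mkQ (word v rfl)) :=
          congrArg (ideal deg (-1)).mkQ (magmaMul_word hw rfl rfl).symm
        rw [e]
        exact bracket_mem_lcs_succ hw _ Submodule.mem_top
  | succ n ih =>
    have hbr : ∀ (c : ℚ) (v : (FreeZGradedLie deg).obj (-1)) (α β : ℚ),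
        v - freeAdPow n α β ∈ (FreeZGradedLie deg).lcs (n + 1) (-1) →
        (FreeZGradedLie deg).bracket (zero_add (-1)) (c • freeX) v
          - freeAdPow (n + 1) (c * α) (c * β) ∈ (FreeZGradedLie deg).lcs (n + 2) (-1) := by
      intro c v α β h
      have := bracket_mem_lcs_succ (zero_add (-1)) (c • freeX) h
      rw [map_sub] at this
      rwa [hsmul, freeAdPow, pow_succ', Module.End.mul_apply, ← LinearMap.smul_apply,
        ← map_smul]
    refine Submodule.span_induction (p := fun u _ => ∃ α β : ℚ,
      u - freeAdPow (n + 1) α β ∈ (FreeZGradedLie deg).lcs (n + 2) (-1)) ?_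
      ⟨0, 0, by simp [hzero]⟩ ?_ ?_ hu
    · rintro _ ⟨p, q, h, u, v, hv, rfl⟩
      rcases lt_or_ge 0 p with hp | hp
      · exact ⟨0, 0, by rw [free_eq_zero hp u]; simp [hzero]⟩
      rcases lt_or_ge 0 q with hq | hq
      · exact ⟨0, 0, by rw [free_eq_zero hq v]; simp [hzero]⟩
      obtain ⟨rfl, rfl⟩ | ⟨rfl, rfl⟩ : p = 0 ∧ q = -1 ∨ p = -1 ∧ q = 0 := by omega
      · obtain ⟨c, rfl⟩ := free_deg_zero u
        obtain ⟨α, β, h⟩ := ih hv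
        exact ⟨_, _, hbr c v α β h⟩
      -- Here the deeper factor `v` is the one of degree `0`. It vanishes in `L²`, so only `n = 0`
      -- remains; there antisymmetry turns `[u, c x]` into `[-c x, u]`.
      · cases n with
        | succ n => exact ⟨0, 0, by rw [lcs_succ_deg_zero n hv]; simp [hzero]⟩
        | zero =>
          obtain ⟨c, rfl⟩ := free_deg_zero v
          obtain ⟨α, β, h'⟩ := ih (u := u) Submodule.mem_top
          refine ⟨-c * α, -c * β, ?_⟩
          rw [(FreeZGradedLie deg).antisymm h (zero_add (-1)), mul_zero, zpow_zero, one_smul,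
            ← LinearMap.neg_apply, ← map_neg, ← neg_smul]
          exact hbr (-c) u α β h'
    · rintro u v - - ⟨α, β, h⟩ ⟨α', β', h'⟩
      refine ⟨α + α', β + β', ?_⟩
      rw [hadd, add_sub_add_comm]
      exact add_mem h h'
    · rintro c u - ⟨α, β, h⟩
      refine ⟨c * α, c * β, ?_⟩
      rw [hsmul, ← smul_sub]
      exact Submodule.smul_mem _ c h

theorem toCompletion_freeAdPow (n : ℕ) (α β : ℚ) :
    (FreeZGradedLie deg).toCompletion (-1) (freeAdPow n α β)
      = ((Complete deg).bracket (zero_add (-1)) x ^ n) (α • a + β • b) := by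
  induction n with
  | zero => rfl
  | succ n ih =>
    rw [pow_succ', Module.End.mul_apply, ← ih, freeAdPow, pow_succ', Module.End.mul_apply]
    rfl

theorem exists_level_succ_eq (n : ℕ) (s : (Complete deg).obj (-1)) (hs : level n s = 0) :
    ∃ α β : ℚ, level (n + 1) s
      = level (n + 1) (((Complete deg).bracket (zero_add (-1)) x ^ n) (α • a + β • b)) := by
  obtain ⟨u, hu⟩ := exists_level_eq (n + 1) s
  have hu' : u ∈ (FreeZGradedLie deg).lcs n (-1) :=
    (Submodule.Quotient.mk_eq_zero _).1 ((level_of_le n.le_succ hu).symm.trans hs)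
  obtain ⟨α, β, h⟩ := lcs_deg_neg_one n hu'
  refine ⟨α, β, hu.trans ?_⟩
  rw [← toCompletion_freeAdPow]
  exact (Submodule.Quotient.eq _).2 h

/-! ### Maurer-Cartan elements -/

theorem linearPart_congr {s t : (Complete deg).obj (-1)} (h : level 1 s = level 1 t) :
    linearPart (-1) s = linearPart (-1) t :=
  congrArg (((FreeZGradedLie deg).lcs 1 (-1)).liftQ (freeLinear deg (-1))
    (lcs_le_ker_freeLinear (-1))) h

theorem linearPart_b : linearPart (-1) b = Finsupp.single .b 1 := by
  change magmaLinear deg (-1) (word (.of .b) rfl) = _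
  simp [magmaLinear, word]

/-- Two Maurer-Cartan elements that agree modulo `Lᵐ⁺²` have the same differential, as seen by the
coefficient of `X ^ m` in the degree `-2` part of the model. -/
theorem coeffTwo_d_sub (α β : ℚ) {m : ℕ} {ω ω' : LSInterval.obj (-1)} (hω : ω ∈ LSInterval.MC)
    (hω' : ω' ∈ LSInterval.MC) (h : level (m + 1) (ω - ω') = 0) :
    coeffTwo α β m ((derivation dGen).map (p := -1) (q := -2) (by norm_num) (ω - ω')) = 0 := by
  have e : ∀ σ ∈ LSInterval.MC,
      coeffTwo α β m ((derivation dGen).map (p := -1) (q := -2) (by norm_num) σ)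
        = -(coeffOne α β 0 σ * coeffOne α β m σ) := fun σ hσ => by
    have := congrArg (coeffTwo α β m) (show
      (derivation dGen).map (p := -1) (q := -2) (by norm_num) σ + (1 / 2 : ℚ) •
        (Complete deg).bracket (p := -1) (q := -1) (r := -2) (by norm_num) σ σ = 0 from hσ)
    rw [map_add, map_smul, coeffTwo_bracket, map_zero, smul_eq_mul] at this
    linear_combination this
  -- Agreement modulo `Lᵐ⁺²` fixes the coefficients of `X ^ 0` and `X ^ m` in degree `-1`, and by
  -- `e` the differential is seen only through these.
  have h' : level (m + 1) ω = level (m + 1) ω' := by rwa [map_sub, sub_eq_zero] at h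
  rw [map_sub, map_sub, e ω hω, e ω' hω', coeffOne_congr (m := 0) (by omega) h',
    coeffOne_congr (m := m) (by omega) h', sub_self]

/-- Induction on word length: the leading term of `ω - ω'` is some `adₓⁿ (α a + β b)`. The linear
part kills it for `n = 0`, and the Maurer-Cartan equation for `n > 0`. -/
theorem level_sub_eq_zero {ω ω' : LSInterval.obj (-1)} (hω : ω ∈ LSInterval.MC)
    (hω' : ω' ∈ LSInterval.MC)
    (h : linearPart (-1) ω = linearPart (-1) ω') (n : ℕ) : level n (ω - ω') = 0 := by
  induction n with
  | zero =>
    obtain ⟨u, hu⟩ := exists_level_eq 0 (ω - ω')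
    exact hu.trans ((Submodule.Quotient.mk_eq_zero _).2 Submodule.mem_top)
  | succ n ih =>
    obtain ⟨α, β, hs⟩ := exists_level_succ_eq n (ω - ω') ih
    suffices α = 0 ∧ β = 0 by
      rw [hs, this.1, this.2]; simp
    cases n with
    | zero =>
      have hl := linearPart_congr hs
      rw [pow_zero, Module.End.one_apply, map_sub, h, sub_self, map_add, map_smul, map_smul,
        linearPart_a, linearPart_b] at hl
      exact ⟨by simpa using (DFunLike.congr_fun hl .a).symm,
        by simpa using (DFunLike.congr_fun hl .b).symm⟩
    | succ m =>
      -- The model parameters `γ`, `δ` are still free. By continuity `∂` of the leading term `adₓᵐ⁺¹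
      -- (α a + β b)` replaces `∂ (ω - ω')` modulo `Lᵐ⁺³`, which is all that the coefficient of `X ^
      -- m` in degree `-2` sees.
      have key : ∀ γ δ : ℚ, (m + 2) * ((δ - γ) * (α * γ + β * δ)) = 0 := fun γ δ => by
        have e := coeffTwo_d_sub γ δ hω hω' ih
        rw [coeffTwo_congr (m := m) le_rfl (derivation_isContinuous dGen _ (m + 2) _ _ hs),
          coeffTwo_d_ad_pow, map_add, map_smul, map_smul, coeffOne_a, coeffOne_b] at e
        simpa using e
      have hm : (m + 2 : ℚ) ≠ 0 := by positivity
      -- Sending `a` to `1` and `b` to `0` isolates `-α`; the opposite choice isolates `β`.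
      have h₁ := (mul_eq_zero.1 (key 1 0)).resolve_left hm
      have h₂ := (mul_eq_zero.1 (key 0 1)).resolve_left hm
      exact ⟨by linarith, by linarith⟩

end LSInterval

end

/-- A Maurer-Cartan element of the Lawrence-Sullivan interval is determined by its linear part. -/
theorem mainTheorem3 (ω ω' : LSInterval.obj (-1)) (hω : ω ∈ LSInterval.MC)
    (hω' : ω' ∈ LSInterval.MC)
    (h : LSInterval.linearPart (-1) ω = LSInterval.linearPart (-1) ω') : ω = ω' :=
  sub_eq_zero.1 (ZGradedLieAlgebra.level_ext fun n =>
    (LSInterval.level_sub_eq_zero hω hω' h n).trans (map_zero _).symm)
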